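/- **Logic and structures.** Formulas are first-order and are interpreted intuitionistically, in Kripke models over an arbitrary preordered set of nodes; a Kripke model of a theory is a Kripke structure that forces (the universal closures of) all its axioms at all nodes. An ordinary structure is a Kripke structure with one node, where forcing is truth. (By soundness and completeness, statement 1 below says that the theory of weakly Euclidean fields proves, in intuitionistic logic, the analytic interpretation of every axiom of EG.) **Weakly Euclidean fields.** The language has $0,1,+,-,\cdot$ and a predicate $P(x)$ ("$x>0$"). Write $x\ge 0$ for $\neg P(-x)$. The *basic axioms* are those of commutative rings and - $\neg\neg\,x=y\to x=y$; $\quad 0\neq 1$; - $P(x)\to\exists y\,(xy=1\wedge P(y))$; - $P(x)\wedge P(y)\to P(x+y)\wedge P(xy)$; - $x+y=0\to\neg(P(x)\wedge P(y))$; - $x+y=0\wedge\neg P(x)\wedge\neg P(y)\to x=0$; - $x+y=0\wedge\neg P(y)\to\exists z\,(z\cdot z=x)$. A *weakly Euclidean field* satisfies in addition the order laws - $P(1)$; $\quad P(x)\wedge y\ge0\to P(x+y)$; $\quad x\ge 0\to\exists z\,(z\ge0\wedge z\cdot z=x)$, which classically follow from the basic axioms but intuitionistically do not. Markov's principle $\neg\neg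 P(x)\to P(x)$ is not assumed. **The plane.** In $\mathbb F^2$, $B(a,b,c)$ means $(c-b)\times(b-a)=0$ and $(b-c)\cdot(a-b)>0$, and $ab=cd$ means $(b-a)^2=(d-c)^2$ (dot products). In a Kripke model the plane is formed at every node. **EG.** The primitives are points with equality, strict betweenness $B$ and equidistance $ab=cd$. Abbreviations: - $T(a,b,c)$: $\neg(a\ne b\wedge\neg B(a,b,c)\wedge b\neq c)$. - $L(a,b,c)$: $\neg\neg(B(c,a,b)\vee c=a\vee B(a,c,b)\vee c=b\vee B(a,b,c))$. - $a\#b$: $\exists c\,(B(c,a,b)\vee B(a,c,b)\vee B(a,b,c))$. - $R(a,b,c)$: $\exists d\,(B(a,b,d)\wedge ab=bd\wedge ac=dc\wedge a\#b\wedge c\#b\wedge a\#c)$. - $Ray(a,b,x)$: $\exists d\,(B(d,a,b)\wedge B(d,a,x))$. - $apex(a,b,c)$: $\exists u,v\,(Ray(b,a,u)\wedge Ray(b,c,v)\wedge bu=bv\wedge u\#v)$. - $\angle abc=\angle a'b'c'$: there are $u,v,u',v'$ with $Ray(b,a,u)$, $Ray(b,c,v)$, $Ray(b',a',u')$, $Ray(b',c',v')$,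 $bu=b'u'$, $bv=b'v'$, $uv=u'v'$. - $0<abc$: $apex(a,b,c)\vee R(a,b,c)\vee\exists a',b',c'\,(\angle abc=\angle a'b'c'\wedge(R(b',a',c')\vee R(a',c',b')))$. - $abc<\pi$: $\exists d\,(B(d,b,a)\wedge 0<dbc)$. $\quad 0<abc<\pi$: the conjunction of both. Axioms: - Stability: $\neg\neg\,a=b\to a=b$; $\neg\neg\,ab=cd\to ab=cd$. - Congruence: $ab=ba$; $ab=pq\wedge ab=rs\to pq=rs$; $ab=cc\to a=b$. - Betweenness: $\neg B(a,b,a)$; $B(a,b,c)\to B(c,b,a)$; $B(a,b,d)\wedge B(b,c,d)\to B(a,b,c)$; $B(a,b,d)\wedge B(a,c,d)\wedge\neg B(a,b,c)\wedge\neg B(a,c,b)\to b=c$. - Extension: $a'\#b'\wedge ab=a'b'\to\exists e\,(T(a,b,e)\wedge be=cd)$; and $a'\#b'\wedge ab=a'b'\wedge c'\#d'\wedge cd=c'd'\to\exists e\,(B(a,b,e)\wedge be=cd)$. - Five segments: $a\#b\wedge T(a,b,c)\wedge T(a',b',c')\wedge ab=a'b'\wedge bc=b'c'\wedge ad=a'd'\wedge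 bd=b'd'\to cd=c'd'$. - Inner Pasch: $B(a,p,c)\wedge B(b,q,c)\wedge(0<acb<\pi\vee0<qpa<\pi)\to\exists x\,(B(p,x,b)\wedge B(a,x,q))$. - Outer Pasch: $B(a,p,c)\wedge B(b,c,q)\wedge(0<baq<\pi\vee 0<abq<\pi)\to\exists x\,(B(b,p,x)\wedge B(a,x,q))$. - Lower dimension: there are $\alpha,\beta,\gamma,c_1,c_2,c_3,c_4$ with $\alpha\beta=\beta\gamma$, $\alpha\beta=\alpha\gamma$, $\alpha\ne\beta$, $B(\alpha,c_1,\beta)$, $\alpha c_1=c_1\beta$, $B(\alpha,c_2,\gamma)$, $\alpha c_2=c_2\gamma$, $B(\beta,c_3,\gamma)$, $\beta c_3=c_3\gamma$, $B(\beta,c_4,c_2)$, $B(\gamma,c_4,c_1)$. - Line-circle: $B(u,a,v)\wedge cu=pq\wedge cv=pq\wedge B(u,c,v)\wedge a\#b\to\exists x,y\,(cx=pq\wedge cy=pq\wedge B(x,a,y)\wedge L(a,b,x)\wedge L(a,b,y))$; and the same with $T$ in place of $B$ throughout. - Circle-circle: $ca=pq\wedge T(u,a,v)\wedge T(u,c',v)\wedge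 c'u=p'q'\wedge c'v=p'q'\wedge cb=pq\wedge B(c',w,b)\wedge c'w=p'q'\to\exists e\,(ce=pq\wedge c'e=p'q')$; and the same with $T(c',w,b)$ in place of $B(c',w,b)$ and the additional hypothesis $c\#c'$. - Euclid 5: $(0<ptr<\pi\vee0<trp<\pi\vee0<rpt<\pi)\wedge pt=qt\wedge B(p,t,q)\wedge st=rt\wedge B(s,t,r)\wedge pr=qs\wedge B(q,a,r)\to\exists e\,(B(p,a,e)\wedge B(s,q,e))$. **Theorem.** 1. For every Kripke model $\mathbb F$ of the axioms of weakly Euclidean fields, the plane $\mathbb F^2$ is a Kripke model of all axioms of EG. 2. In particular for structures in the usual sense: for every commutative ring $\mathbb F$ with a predicate $P$ that satisfies the basic axioms, the plane $\mathbb F^2$ satisfies all axioms of EG. -/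

import Mathlib

/-!
Intuitionistic first-order logic with its Kripke semantics, planes over Kripke models of the theory
of weakly Euclidean fields, and the axioms of non-Markovian Euclidean geometry EG.
-/

namespace NonMarkov

universe u v

/-! ### Intuitionistic first-order formulas and Kripke forcing -/

/-- First-order formulas with atomic formulas from `At` and free variables in `V`.  All connectives
and quantifiers are primitive, as intuitionistic logic requires.  A quantifier binds the variable
`none` of its body; a free variable `x` of the quantified formula is `some x` in the body. -/
inductive Formula (At : Type → Type) : Type → Type 1
  | atom {V : Type} (α : At V) : Formula At V
  | falsum {V : Type} : Formula At V
  | and {V : Type} (φ ψ : Formula At V) : Formula At V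
  | or {V : Type} (φ ψ : Formula At V) : Formula At V
  | imp {V : Type} (φ ψ : Formula At V) : Formula At V
  | all {V : Type} (φ : Formula At (Option V)) : Formula At V
  | ex {V : Type} (φ : Formula At (Option V)) : Formula At V

namespace Formula

variable {At : Type → Type} {V : Type}

/-- Intuitionistic negation. -/
def neg (φ : Formula At V) : Formula At V := imp φ falsum

end Formula

infixr:66 " ⋏ " => NonMarkov.Formula.and
infixr:65 " ⋎ " => NonMarkov.Formula.or
infixr:60 " ⟹ " => NonMarkov.Formula.imp
prefix:70 "∼" => NonMarkov.Formula.neg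

/-- A Kripke structure over the (pre)ordered set of nodes `W`: a domain at each node, transition
maps along the order, and at each node an interpretation of the atomic formulas that persists along
the transition maps.  Equality is among the atoms; in the two structures used below it is
interpreted at each node as actual equality in the domain. -/
structure KripkeStructure (At : Type → Type) (W : Type v) [Preorder W] where
  Dom : W → Type u
  map : ∀ {w w' : W}, w ≤ w' → Dom w → Dom w'
  map_refl : ∀ (w : W) (x : Dom w), map (le_refl w) x = x
  map_trans : ∀ {w w' w'' : W} (h : w ≤ w') (h' : w' ≤ w'') (x : Dom w),
    map h' (map h x) = map (le_trans h h') x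
  Holds : ∀ {V : Type} (w : W), At V → (V → Dom w) → Prop
  holds_map : ∀ {V : Type} {w w' : W} (h : w ≤ w') (α : At V) (s : V → Dom w),
    Holds w α s → Holds w' α (fun i => map h (s i))

namespace KripkeStructure

variable {At : Type → Type} {W : Type v} [Preorder W]

/-- Extend an assignment by a value for the bound variable `none`. -/
def extend {V : Type} {D : Type u} (s : V → D) (x : D) : Option V → D
  | none => x
  | some i => s i

/-- The Kripke forcing relation. -/
def Forces (M : KripkeStructure.{u, v} At W) :
    {V : Type} → Formula At V → (w : W) → (V → M.Dom w) → Prop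
  | _, .atom α, w, s => M.Holds w α s
  | _, .falsum, _, _ => False
  | _, .and φ ψ, w, s => M.Forces φ w s ∧ M.Forces ψ w s
  | _, .or φ ψ, w, s => M.Forces φ w s ∨ M.Forces ψ w s
  | _, .imp φ ψ, w, s => ∀ (w' : W) (h : w ≤ w'),
      M.Forces φ w' (fun i => M.map h (s i)) → M.Forces ψ w' (fun i => M.map h (s i))
  | _, .all φ, w, s => ∀ (w' : W) (h : w ≤ w') (x : M.Dom w'),
      M.Forces φ w' (extend (fun i => M.map h (s i)) x)
  | _, .ex φ, w, s => ∃ x : M.Dom w, M.Forces φ w (extend s x)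

/-- `M` is a Kripke model of the set of axioms `T`: the universal closure of every axiom is forced
at every node. -/
def Models (M : KripkeStructure.{u, v} At W) {V : Type} (T : Set (Formula At V)) : Prop :=
  ∀ φ ∈ T, ∀ (w : W) (s : V → M.Dom w), M.Forces φ w s

end KripkeStructure

/-! ### Weakly Euclidean fields -/

/-- Atomic formulas of the language of ordered rings: equations between terms, and `P(t)`.  Terms
are represented by integer polynomials in the variables. -/
inductive FieldAtom (V : Type) : Type
  | eq (t t' : MvPolynomial V ℤ) : FieldAtom V
  | pos (t : MvPolynomial V ℤ) : FieldAtom V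

/-- Formulas of the language of ordered rings. -/
abbrev FieldFormula (V : Type) := Formula FieldAtom V

namespace FieldFormula

open MvPolynomial

variable {V : Type}

/-- `t = t'` -/
def eq (t t' : MvPolynomial V ℤ) : FieldFormula V := .atom (.eq t t')

/-- `P(t)`: `t` is positive -/
def pos (t : MvPolynomial V ℤ) : FieldFormula V := .atom (.pos t)

/-- `¬ ¬ x = y → x = y` -/
noncomputable def stability : FieldFormula (Fin 2) :=
  ∼∼(eq (X 0) (X 1)) ⟹ eq (X 0) (X 1)

/-- `0 ≠ 1` -/
noncomputable def ef0 : FieldFormula (Fin 2) := ∼(eq 0 1)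

/-- `P(x) → ∃ y, x y = 1 ∧ P(y)` -/
noncomputable def ef1 : FieldFormula (Fin 2) :=
  pos (X 0) ⟹ .ex (eq (X (some 0) * X none) 1 ⋏ pos (X none))

/-- `P(x) ∧ P(y) → P(x + y) ∧ P(x y)` -/
noncomputable def ef2 : FieldFormula (Fin 2) :=
  (pos (X 0) ⋏ pos (X 1)) ⟹ (pos (X 0 + X 1) ⋏ pos (X 0 * X 1))

/-- `x + y = 0 → ¬ (P(x) ∧ P(y))` -/
noncomputable def ef3 : FieldFormula (Fin 2) :=
  eq (X 0 + X 1) 0 ⟹ ∼(pos (X 0) ⋏ pos (X 1))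

/-- `x + y = 0 ∧ ¬ P(x) ∧ ¬ P(y) → x = 0` -/
noncomputable def ef4 : FieldFormula (Fin 2) :=
  (eq (X 0 + X 1) 0 ⋏ ∼(pos (X 0)) ⋏ ∼(pos (X 1))) ⟹ eq (X 0) 0

/-- `x + y = 0 ∧ ¬ P(y) → ∃ z, z z = x` -/
noncomputable def ef5 : FieldFormula (Fin 2) :=
  (eq (X 0 + X 1) 0 ⋏ ∼(pos (X 1))) ⟹ .ex (eq (X none * X none) (X (some 0)))

/-- `P(1)` -/
noncomputable def onePos : FieldFormula (Fin 2) := pos 1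

/-- `P(x) ∧ ¬ P(-y) → P(x + y)`, that is, `0 < x ∧ 0 ≤ y → 0 < x + y` -/
noncomputable def addPos : FieldFormula (Fin 2) :=
  (pos (X 0) ⋏ ∼(pos (-X 1))) ⟹ pos (X 0 + X 1)

/-- `¬ P(-x) → ∃ z, ¬ P(-z) ∧ z z = x`: the square root of a non-negative element can be chosen
non-negative. -/
noncomputable def sqrtNonneg : FieldFormula (Fin 2) :=
  ∼(pos (-X 0)) ⟹ .ex (∼(pos (-X none)) ⋏ eq (X none * X none) (X (some 0)))

/-- Stability of equality together with `0 ≠ 1` and the basic axioms on `P`, inverses and square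
roots. -/
def basicAxioms : Set (FieldFormula (Fin 2)) :=
  {stability, ef0, ef1, ef2, ef3, ef4, ef5}

/-- The order laws `0 < 1`, `0 < x ∧ 0 ≤ y → 0 < x + y`, and `√x ≥ 0`.  In classical logic they
follow from the basic axioms; intuitionistically they do not. -/
def orderLaws : Set (FieldFormula (Fin 2)) :=
  {onePos, addPos, sqrtNonneg}

/-- The axioms of weakly Euclidean fields (apart from those of commutative rings).  Markov's
principle `¬ ¬ P(x) → P(x)` is not among them. -/
def weaklyEuclidean : Set (FieldFormula (Fin 2)) := basicAxioms ∪ orderLaws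

end FieldFormula

/-- A Kripke structure for the language of ordered rings in which the axioms of commutative rings
are forced.  As these axioms are equations, this means that every node carries a commutative ring
and that the transition maps are ring homomorphisms.  `Pos` interprets the predicate `P`. -/
structure OrderedKripkeRing (W : Type v) [Preorder W] where
  F : W → Type u
  [ring : ∀ w, CommRing (F w)]
  map : ∀ {w w' : W}, w ≤ w' → F w →+* F w'
  map_refl : ∀ (w : W) (x : F w), map (le_refl w) x = x
  map_trans : ∀ {w w' w'' : W} (h : w ≤ w') (h' : w' ≤ w'') (x : F w),
    map h' (map h x) = map (le_trans h h') x
  Pos : ∀ w : W, F w → Prop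
  pos_map : ∀ {w w' : W} (h : w ≤ w') (x : F w), Pos w x → Pos w' (map h x)

attribute [instance] OrderedKripkeRing.ring

/-- Cross product in the plane over a commutative ring. -/
def cross {R : Type u} [CommRing R] (x y : R × R) : R := x.1 * y.2 - x.2 * y.1

/-- Dot product in the plane over a commutative ring. -/
def dot {R : Type u} [CommRing R] (x y : R × R) : R := x.1 * y.1 + x.2 * y.2

/-- Atomic formulas of the language of geometry: equality of points, strict betweenness `B(a,b,c)`
and equidistance `E(a,b,c,d)`, that is, `ab = cd`. -/
inductive GeoAtom (V : Type) : Type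
  | eq (a b : V) : GeoAtom V
  | btw (a b c : V) : GeoAtom V
  | cong (a b c d : V) : GeoAtom V

namespace OrderedKripkeRing

variable {W : Type v} [Preorder W]

/-- The interpretation of the atomic field formulas at a node. -/
def AtomHolds (K : OrderedKripkeRing.{u, v} W) {V : Type} (w : W) (s : V → K.F w) :
    FieldAtom V → Prop
  | .eq t t' => MvPolynomial.aeval s t = MvPolynomial.aeval s t'
  | .pos t => K.Pos w (MvPolynomial.aeval s t)

theorem map_aeval (K : OrderedKripkeRing.{u, v} W) {V : Type} {w w' : W} (h : w ≤ w')
    (s : V → K.F w) (t : MvPolynomial V ℤ) :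
    K.map h (MvPolynomial.aeval s t) = MvPolynomial.aeval (fun i => K.map h (s i)) t := by
  induction t using MvPolynomial.induction_on with
  | C a => simp
  | add p q hp hq => simp [hp, hq]
  | mul_X p i hp => simp [hp]

/-- The Kripke structure for the language of ordered rings. -/
def toKripke (K : OrderedKripkeRing.{u, v} W) : KripkeStructure.{u, v} FieldAtom W where
  Dom := K.F
  map h := K.map h
  map_refl := K.map_refl
  map_trans := K.map_trans
  Holds w α s := K.AtomHolds w s α
  holds_map := by
    rintro V w w' h (⟨t, t'⟩ | ⟨t⟩) s hs
    · simp only [AtomHolds] at hs ⊢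
      rw [← K.map_aeval, ← K.map_aeval, hs]
    · simp only [AtomHolds] at hs ⊢
      rw [← K.map_aeval]
      exact K.pos_map h _ hs

/-- The interpretation of the atomic formulas of geometry in the plane at a node: `B(a,b,c)` means
`(c - b) × (b - a) = 0` and `(b - c) · (a - b) > 0`, and `ab = cd` means
`(b - a)² = (d - c)²`. -/
def PlaneHolds (K : OrderedKripkeRing.{u, v} W) {V : Type} (w : W) (s : V → K.F w × K.F w) :
    GeoAtom V → Prop
  | .eq a b => s a = s b
  | .btw a b c =>
      cross (s c - s b) (s b - s a) = 0 ∧ K.Pos w (dot (s b - s c) (s a - s b))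
  | .cong a b c d => dot (s b - s a) (s b - s a) = dot (s d - s c) (s d - s c)

/-- The plane: the Kripke structure for the language of geometry whose domain at each node is
the plane over the ring at that node. -/
def plane (K : OrderedKripkeRing.{u, v} W) : KripkeStructure.{u, v} GeoAtom W where
  Dom w := K.F w × K.F w
  map h x := (K.map h x.1, K.map h x.2)
  map_refl w x := by simp [K.map_refl]
  map_trans h h' x := by simp [K.map_trans]
  Holds w α s := K.PlaneHolds w s α
  holds_map := by
    rintro V w w' h (⟨a, b⟩ | ⟨a, b, c⟩ | ⟨a, b, c, d⟩) s hs
    · simp only [PlaneHolds] at hs ⊢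
      rw [hs]
    · simp only [PlaneHolds] at hs ⊢
      refine ⟨?_, ?_⟩
      · have := congrArg (K.map h) hs.1
        simpa [cross] using this
      · have := K.pos_map h _ hs.2
        simpa [dot] using this
    · simp only [PlaneHolds] at hs ⊢
      have := congrArg (K.map h) hs
      simpa [dot] using this

/-- An ordinary structure: a commutative ring with a predicate `P`, as a Kripke structure with one
node.  Forcing at the only node is truth in the structure in the usual sense. -/
def single (F : Type u) [CommRing F] (P : F → Prop) : OrderedKripkeRing.{u, 0} PUnit where
  F _ := F
  map _ := RingHom.id F
  map_refl _ _ := rfl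
  map_trans _ _ _ := rfl
  Pos _ := P
  pos_map _ _ hx := hx

end OrderedKripkeRing

/-! ### The axioms of EG -/

/-- Formulas of the language of geometry. -/
abbrev GeoFormula (V : Type) := Formula GeoAtom V

namespace GeoFormula

variable {V : Type}

/-- `a = b` -/
def eq (a b : V) : GeoFormula V := .atom (.eq a b)

/-- `a ≠ b` -/
def ne (a b : V) : GeoFormula V := ∼(eq a b)

/-- `B(a,b,c)`: strict betweenness -/
def btw (a b c : V) : GeoFormula V := .atom (.btw a b c)

/-- `ab = cd` -/
def cong (a b c d : V) : GeoFormula V := .atom (.cong a b c d)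

/-- `T(a,b,c)`: non-strict betweenness, `¬ (a ≠ b ∧ ¬ B(a,b,c) ∧ b ≠ c)` -/
def tbtw (a b c : V) : GeoFormula V := ∼(ne a b ⋏ ∼(btw a b c) ⋏ ne b c)

/-- `L(a,b,c)`: collinearity,
`¬ ¬ (B(c,a,b) ∨ c = a ∨ B(a,c,b) ∨ c = b ∨ B(a,b,c))` -/
def col (a b c : V) : GeoFormula V :=
  ∼∼(btw c a b ⋎ eq c a ⋎ btw a c b ⋎ eq c b ⋎ btw a b c)

/-- `a # b`: the points are distinct, `∃ c, B(c,a,b) ∨ B(a,c,b) ∨ B(a,b,c)` -/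
def distinct (a b : V) : GeoFormula V :=
  .ex (btw none (some a) (some b) ⋎ btw (some a) none (some b) ⋎ btw (some a) (some b) none)

/-- `R(a,b,c)`: `abc` is a right angle,
`∃ d, B(a,b,d) ∧ ab = bd ∧ ac = dc ∧ a # b ∧ c # b ∧ a # c` -/
def right (a b c : V) : GeoFormula V :=
  .ex (btw (some a) (some b) none ⋏ cong (some a) (some b) (some b) none ⋏
    cong (some a) (some c) none (some c) ⋏ distinct (some a) (some b) ⋏
    distinct (some c) (some b) ⋏ distinct (some a) (some c))

/-- `Ray(a,b,x)`: `x` lies on the open ray from `a` through `b`,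
`∃ d, B(d,a,b) ∧ B(d,a,x)` -/
def ray (a b x : V) : GeoFormula V :=
  .ex (btw none (some a) (some b) ⋏ btw none (some a) (some x))

/-- `abc` is an apex angle,
`∃ u v, Ray(b,a,u) ∧ Ray(b,c,v) ∧ bu = bv ∧ u # v` -/
def apex (a b c : V) : GeoFormula V :=
  .ex (.ex (
    let u : Option (Option V) := some none
    let v : Option (Option V) := none
    let a : Option (Option V) := some (some a)
    let b : Option (Option V) := some (some b)
    let c : Option (Option V) := some (some c)
    ray b a u ⋏ ray b c v ⋏ cong b u b v ⋏ distinct u v))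

/-- The angles `abc` and `a'b'c'` are congruent: there are `u`, `v`, `u'`, `v'` on
`Ray(b,a)`, `Ray(b,c)`, `Ray(b',a')`, `Ray(b',c')` with
`bu = b'u'`, `bv = b'v'` and `uv = u'v'`. -/
def angleCong (a b c a' b' c' : V) : GeoFormula V :=
  .ex (.ex (.ex (.ex (
    let u : Option (Option (Option (Option V))) := some (some (some none))
    let v : Option (Option (Option (Option V))) := some (some none)
    let u' : Option (Option (Option (Option V))) := some none
    let v' : Option (Option (Option (Option V))) := none
    let i : V → Option (Option (Option (Option V))) := fun x => some (some (some (some x)))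
    ray (i b) (i a) u ⋏ ray (i b) (i c) v ⋏ ray (i b') (i a') u' ⋏ ray (i b') (i c') v' ⋏
      cong (i b) u (i b') u' ⋏ cong (i b) v (i b') v' ⋏ cong u v u' v'))))

/-- `0 < abc`: `abc` is an apex angle, or a right angle, or congruent to an angle `a'b'c'` of a
right triangle, with right angle `b'a'c'` or `a'c'b'`. -/
def angPos (a b c : V) : GeoFormula V :=
  apex a b c ⋎ right a b c ⋎
  .ex (.ex (.ex (
    let a' : Option (Option (Option V)) := some (some none)
    let b' : Option (Option (Option V)) := some none
    let c' : Option (Option (Option V)) := none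
    let i : V → Option (Option (Option V)) := fun x => some (some (some x))
    angleCong (i a) (i b) (i c) a' b' c' ⋏ (right b' a' c' ⋎ right a' c' b'))))

/-- `abc < π`: `∃ d, B(d,b,a) ∧ 0 < dbc` -/
def angLtPi (a b c : V) : GeoFormula V :=
  .ex (btw none (some b) (some a) ⋏ angPos none (some b) (some c))

/-- `0 < abc < π` -/
def angProper (a b c : V) : GeoFormula V := angPos a b c ⋏ angLtPi a b c

end GeoFormula

/-- Names for the free variables of the axioms. -/
inductive Pt : Type
  | a | b | c | d | p | q | r | s | t | u | v | w
  | a' | b' | c' | d' | p' | q'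

namespace EG

open GeoFormula Pt

/-- `¬ ¬ a = b → a = b` -/
def stabilityEq : GeoFormula Pt := ∼∼(eq a b) ⟹ eq a b

/-- `¬ ¬ ab = cd → ab = cd` -/
def stabilityCong : GeoFormula Pt := ∼∼(cong a b c d) ⟹ cong a b c d

/-- `ab = ba` -/
def a1 : GeoFormula Pt := cong a b b a

/-- `ab = pq ∧ ab = rs → pq = rs` -/
def a2 : GeoFormula Pt := (cong a b p q ⋏ cong a b r s) ⟹ cong p q r s

/-- `ab = cc → a = b` -/
def a3 : GeoFormula Pt := cong a b c c ⟹ eq a b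

/-- `¬ B(a,b,a)` -/
def a6 : GeoFormula Pt := ∼(btw a b a)

/-- symmetry of betweenness: `B(a,b,c) → B(c,b,a)` -/
def a14 : GeoFormula Pt := btw a b c ⟹ btw c b a

/-- inner transitivity: `B(a,b,d) ∧ B(b,c,d) → B(a,b,c)` -/
def a15 : GeoFormula Pt := (btw a b d ⋏ btw b c d) ⟹ btw a b c

/-- connectivity:
`B(a,b,d) ∧ B(a,c,d) ∧ ¬ B(a,b,c) ∧ ¬ B(a,c,b) → b = c` -/
def a17 : GeoFormula Pt :=
  (btw a b d ⋏ btw a c d ⋏ ∼(btw a b c) ⋏ ∼(btw a c b)) ⟹ eq b c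

/-- extension: `a' # b' ∧ ab = a'b' → ∃ e, T(a,b,e) ∧ be = cd` -/
def extension : GeoFormula Pt :=
  (distinct a' b' ⋏ cong a b a' b') ⟹
    .ex (tbtw (some a) (some b) none ⋏ cong (some b) none (some c) (some d))

/-- strict extension:
`a' # b' ∧ ab = a'b' ∧ c' # d' ∧ cd = c'd' → ∃ e, B(a,b,e) ∧ be = cd` -/
def strictExtension : GeoFormula Pt :=
  (distinct a' b' ⋏ cong a b a' b' ⋏ distinct c' d' ⋏ cong c d c' d') ⟹
    .ex (btw (some a) (some b) none ⋏ cong (some b) none (some c) (some d))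

/-- five-segment axiom: `a # b ∧ T(a,b,c) ∧ T(a',b',c') ∧ ab = a'b' ∧ bc = b'c' ∧
ad = a'd' ∧ bd = b'd' → cd = c'd'` -/
def fiveSegment : GeoFormula Pt :=
  (distinct a b ⋏ tbtw a b c ⋏ tbtw a' b' c' ⋏ cong a b a' b' ⋏ cong b c b' c' ⋏
    cong a d a' d' ⋏ cong b d b' d') ⟹ cong c d c' d'

/-- inner Pasch: `B(a,p,c) ∧ B(b,q,c) ∧ (0 < acb < π ∨ 0 < qpa < π) →
∃ x, B(p,x,b) ∧ B(a,x,q)` -/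
def innerPasch : GeoFormula Pt :=
  (btw a p c ⋏ btw b q c ⋏ (angProper a c b ⋎ angProper q p a)) ⟹
    .ex (btw (some p) none (some b) ⋏ btw (some a) none (some q))

/-- outer Pasch: `B(a,p,c) ∧ B(b,c,q) ∧ (0 < baq < π ∨ 0 < abq < π) →
∃ x, B(b,p,x) ∧ B(a,x,q)` -/
def outerPasch : GeoFormula Pt :=
  (btw a p c ⋏ btw b c q ⋏ (angProper b a q ⋎ angProper a b q)) ⟹
    .ex (btw (some b) (some p) none ⋏ btw (some a) none (some q))

/-- Lower dimension axiom: there is an equilateral triangle `αβγ` with midpoints `c₁`, `c₂`, `c₃`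
of its sides, two of whose medians meet in a point `c₄`. -/
def lowerDimension : GeoFormula Pt :=
  .ex (.ex (.ex (.ex (.ex (.ex (.ex (
    let α := some (some (some (some (some (some none)))))
    let β := some (some (some (some (some none))))
    let γ := some (some (some (some none)))
    let c₁ := some (some (some none))
    let c₂ := some (some none)
    let c₃ := some none
    let c₄ := none
    cong α β β γ ⋏ cong α β α γ ⋏ ne α β ⋏
      btw α c₁ β ⋏ cong α c₁ c₁ β ⋏
      btw α c₂ γ ⋏ cong α c₂ c₂ γ ⋏
      btw β c₃ γ ⋏ cong β c₃ c₃ γ ⋏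
      btw β c₄ c₂ ⋏ btw γ c₄ c₁)))))))

/-- Line-circle continuity: if `a` lies strictly inside the circle with center `c` and radius `pq`
(as witnessed by a diameter `uv`), then every line `ab` with `a # b` meets the circle in points
`x`, `y` with `a` strictly between them. -/
def lineCircle : GeoFormula Pt :=
  (btw u a v ⋏ cong c u p q ⋏ cong c v p q ⋏ btw u c v ⋏ distinct a b) ⟹
    .ex (.ex (
      let x := some none
      let y := none
      let i : Pt → Option (Option Pt) := fun z => some (some z)
      cong (i c) x (i p) (i q) ⋏ cong (i c) y (i p) (i q) ⋏ btw x (i a) y ⋏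
        col (i a) (i b) x ⋏ col (i a) (i b) y))

/-- Non-strict line-circle continuity: the same with `T` in place of `B`. -/
def lineCircleNonstrict : GeoFormula Pt :=
  (tbtw u a v ⋏ cong c u p q ⋏ cong c v p q ⋏ tbtw u c v ⋏ distinct a b) ⟹
    .ex (.ex (
      let x := some none
      let y := none
      let i : Pt → Option (Option Pt) := fun z => some (some z)
      cong (i c) x (i p) (i q) ⋏ cong (i c) y (i p) (i q) ⋏ tbtw x (i a) y ⋏
        col (i a) (i b) x ⋏ col (i a) (i b) y))

/-- Circle-circle continuity: if the circle with center `c` and radius `pq` has a point `a`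
non-strictly inside the circle with center `c'` and radius `p'q'`, and a point `b` outside it, then
the circles meet. -/
def circleCircle : GeoFormula Pt :=
  (cong c a p q ⋏ tbtw u a v ⋏ tbtw u c' v ⋏ cong c' u p' q' ⋏ cong c' v p' q' ⋏
    cong c b p q ⋏ btw c' w b ⋏ cong c' w p' q') ⟹
    .ex (cong (some c) none (some p) (some q) ⋏ cong (some c') none (some p') (some q'))

/-- Circle-circle continuity for circles with distinct centers, with `b` non-strictly outside. -/
def circleCircleNonstrict : GeoFormula Pt :=
  (distinct c c' ⋏
    cong c a p q ⋏ tbtw u a v ⋏ tbtw u c' v ⋏ cong c' u p' q' ⋏ cong c' v p' q' ⋏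
    cong c b p q ⋏ tbtw c' w b ⋏ cong c' w p' q') ⟹
    .ex (cong (some c) none (some p) (some q) ⋏ cong (some c') none (some p') (some q'))

/-- Euclid 5, for a non-degenerate triangle `ptr` (one of whose angles is positive and has a
positive supplement): `pt = qt ∧ B(p,t,q) ∧ st = rt ∧ B(s,t,r) ∧ pr = qs ∧ B(q,a,r) →
∃ e, B(p,a,e) ∧ B(s,q,e)` -/
def euclid5 : GeoFormula Pt :=
  ((angProper p t r ⋎ angProper t r p ⋎ angProper r p t) ⋏
    cong p t q t ⋏ btw p t q ⋏ cong s t r t ⋏ btw s t r ⋏ cong p r q s ⋏ btw q a r) ⟹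
    .ex (btw (some p) (some a) none ⋏ btw (some s) (some q) none)

/-- The axioms of EG. -/
def axiomsEG : Set (GeoFormula Pt) :=
  {stabilityEq, stabilityCong, a1, a2, a3, a6, a14, a15, a17, extension, strictExtension,
    fiveSegment, innerPasch, outerPasch, lowerDimension, lineCircle, lineCircleNonstrict,
    circleCircle, circleCircleNonstrict, euclid5}

end EG

end NonMarkov

namespace NonMarkov

universe u v

/-! ### Forcing of double negations and of implications -/

section Forcing

variable {At : Type → Type} {W : Type v} [Preorder W] {V : Type}

variable (M : KripkeStructure.{u, v} At W)

/-! Forcing in the plane is reduced to algebra in the ring at one node, with `P` for forced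
positivity and `N` for forced nonnegativity. Signs are not decidable there, and without Markov's
principle positivity cannot be proved by contradiction, so the two predicates need different
methods.

Nonnegativity is a negation, and an equation amounts to two nonnegativity statements.
`exists_orderedHom` maps the ring at `w` to a linearly ordered ring, preserving `≥ 0` and making
strictly positive whatever is positive at a given later node. If `x ≥ 0` failed at `w`, then `-x`
would be positive at some later node, and such a map would make `x` negative. Hence `nonneg_of_hom`:
nonnegativity may be checked in ordered rings, where case splits on signs are allowed. Positivity
has to be built from sums, products and inverses, and from `pos_of_mul`, which extracts `x > 0` from
`x * y > 0` when both factors are nonnegative. This gives positive square roots and, with Lagrange's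
identity, apartness of points from a nonvanishing cross or dot product.

In these terms `a # b` says that the squared distance is positive, and `T(a,b,c)` says that the
cross product vanishes and the dot product is nonnegative. A positive angle with legs `A`, `C`
yields `|A||C| - A·C > 0`. If its supplement is positive as well, multiplying the two inequalities
gives `(A × C)² > 0` (`pos_cross_of_angPos`). With that, Pasch and Euclid 5 are solved by explicit
intersection points. The circle axioms become quadratic equations whose discriminants are
nonnegative in every ordered ring.

For a single node, forcing is classical truth, and the order laws follow from the basic axioms. -/

theorem KripkeStructure.forces_neg (φ : Formula At V) (w : W) (s : V → M.Dom w) :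
    M.Forces (∼φ) w s ↔ ∀ (w' : W) (h : w ≤ w'), ¬ M.Forces φ w' (fun i => M.map h (s i)) :=
  Iff.rfl

theorem KripkeStructure.forces_neg_neg (φ : Formula At V) (w : W) (s : V → M.Dom w) :
    M.Forces (∼∼φ) w s ↔ ∀ (w' : W) (h : w ≤ w'), ∃ (w'' : W) (h' : w' ≤ w''),
      M.Forces φ w'' (fun i => M.map (h.trans h') (s i)) := by
  simp only [forces_neg, M.map_trans]
  push Not
  rfl

theorem KripkeStructure.forces_imp_of {φ ψ : Formula At V}
    (H : ∀ (w : W) (s : V → M.Dom w), M.Forces φ w s → M.Forces ψ w s) (w : W)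
    (s : V → M.Dom w) : M.Forces (φ ⟹ ψ) w s :=
  fun w' _ => H w' _

end Forcing

/-! ### The axioms of weakly Euclidean fields, semantically -/

namespace OrderedKripkeRing

variable {W : Type v} [Preorder W] (K : OrderedKripkeRing.{u, v} W)

/-- `x ≥ 0`, that is, `¬ P(-x)`, is forced at `w`. -/
def Nonneg (w : W) (x : K.F w) : Prop := ∀ (w' : W) (h : w ≤ w'), ¬ K.Pos w' (-K.map h x)

/-- The semantic content of the basic axioms. -/
structure IsBasic : Prop where
  eq_of_dense : ∀ (w : W) (x y : K.F w),
    (∀ (w' : W) (h : w ≤ w'), ∃ (w'' : W) (h' : w' ≤ w''),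
      K.map (h.trans h') x = K.map (h.trans h') y) → x = y
  zero_ne_one : ∀ w : W, (0 : K.F w) ≠ 1
  exists_inv : ∀ (w : W) (x : K.F w), K.Pos w x → ∃ y, x * y = 1 ∧ K.Pos w y
  add : ∀ (w : W) (x y : K.F w), K.Pos w x → K.Pos w y → K.Pos w (x + y)
  mul : ∀ (w : W) (x y : K.F w), K.Pos w x → K.Pos w y → K.Pos w (x * y)
  not_pos_neg : ∀ (w : W) (x : K.F w), K.Pos w x → ¬ K.Pos w (-x)
  eq_zero : ∀ (w : W) (x : K.F w), K.Nonneg w x → K.Nonneg w (-x) → x = 0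
  exists_mul_self : ∀ (w : W) (x : K.F w), K.Nonneg w x → ∃ z, z * z = x

/-- The semantic content of the axioms of weakly Euclidean fields. -/
structure IsWeaklyEuclidean : Prop extends K.IsBasic where
  one : ∀ w : W, K.Pos w 1
  add_nonneg : ∀ (w : W) (x y : K.F w), K.Pos w x → K.Nonneg w y → K.Pos w (x + y)
  exists_sqrt : ∀ (w : W) (x : K.F w), K.Nonneg w x → ∃ z, K.Nonneg w z ∧ z * z = x

theorem map_map {w w' w'' : W} (h : w ≤ w') (h' : w' ≤ w'') (x : K.F w) :
    K.map h' (K.map h x) = K.map (h.trans h') x := K.map_trans h h' x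

variable {K}

theorem isBasic_of_models (hK : K.toKripke.Models FieldFormula.basicAxioms) : K.IsBasic where
  eq_of_dense w x y hxy := by
    have := hK FieldFormula.stability (by simp [FieldFormula.basicAxioms]) w ![x, y] w le_rfl
    simp only [KripkeStructure.forces_neg, FieldFormula.eq, KripkeStructure.Forces, toKripke,
      AtomHolds, MvPolynomial.aeval_X, K.map_refl] at this
    refine this ?_
    intro w' h hn
    obtain ⟨w'', h', e⟩ := hxy w' h
    refine hn w'' h' ?_
    simpa [K.map_map] using e
  zero_ne_one w := by
    have := hK FieldFormula.ef0 (by simp [FieldFormula.basicAxioms]) w (fun _ => (0 : K.F w)) w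
      le_rfl
    simpa [FieldFormula.eq, KripkeStructure.Forces, toKripke, AtomHolds] using this
  exists_inv w x hx := by
    have := hK FieldFormula.ef1 (by simp [FieldFormula.basicAxioms]) w ![x, x] w le_rfl
    simp only [FieldFormula.eq, FieldFormula.pos, KripkeStructure.Forces, toKripke,
      AtomHolds, MvPolynomial.aeval_X, K.map_refl, map_mul, map_one] at this
    exact this hx
  add w x y hx hy := by
    have := hK FieldFormula.ef2 (by simp [FieldFormula.basicAxioms]) w ![x, y] w le_rfl
    simp only [FieldFormula.pos, KripkeStructure.Forces, toKripke,
      AtomHolds, MvPolynomial.aeval_X, K.map_refl, map_mul, map_add] at this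
    exact (this ⟨hx, hy⟩).1
  mul w x y hx hy := by
    have := hK FieldFormula.ef2 (by simp [FieldFormula.basicAxioms]) w ![x, y] w le_rfl
    simp only [FieldFormula.pos, KripkeStructure.Forces, toKripke,
      AtomHolds, MvPolynomial.aeval_X, K.map_refl, map_mul, map_add] at this
    exact (this ⟨hx, hy⟩).2
  not_pos_neg w x hx hy := by
    have := hK FieldFormula.ef3 (by simp [FieldFormula.basicAxioms]) w ![x, -x] w le_rfl
    simp only [FieldFormula.pos, FieldFormula.eq, KripkeStructure.forces_neg,
      KripkeStructure.Forces, toKripke,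
      AtomHolds, MvPolynomial.aeval_X, K.map_refl, map_zero, map_add] at this
    exact this (by simp) w le_rfl ⟨by simpa [K.map_refl] using hx, by simpa [K.map_refl] using hy⟩
  eq_zero w x hx hy := by
    have := hK FieldFormula.ef4 (by simp [FieldFormula.basicAxioms]) w ![x, -x] w le_rfl
    simp only [FieldFormula.pos, FieldFormula.eq, KripkeStructure.forces_neg,
      KripkeStructure.Forces, toKripke,
      AtomHolds, MvPolynomial.aeval_X, K.map_refl, map_zero, map_add] at this
    exact this ⟨by simp, fun w' h => by simpa using hy w' h, fun w' h => by simpa using hx w' h⟩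
  exists_mul_self w x hx := by
    have := hK FieldFormula.ef5 (by simp [FieldFormula.basicAxioms]) w ![x, -x] w le_rfl
    simp only [FieldFormula.pos, FieldFormula.eq, KripkeStructure.forces_neg,
      KripkeStructure.Forces, toKripke,
      AtomHolds, MvPolynomial.aeval_X, K.map_refl, map_zero, map_add, map_mul] at this
    exact this ⟨by simp, fun w' h => by simpa using hx w' h⟩

theorem isWeaklyEuclidean_of_models (hK : K.toKripke.Models FieldFormula.weaklyEuclidean) :
    K.IsWeaklyEuclidean where
  toIsBasic := isBasic_of_models fun φ hφ => hK φ (.inl hφ)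
  one w := by
    have := hK FieldFormula.onePos (by simp [FieldFormula.weaklyEuclidean,
      FieldFormula.orderLaws]) w (fun _ => (0 : K.F w))
    simpa [FieldFormula.onePos, FieldFormula.pos, KripkeStructure.Forces, toKripke,
      AtomHolds] using this
  add_nonneg w x y hx hy := by
    have := hK FieldFormula.addPos (by simp [FieldFormula.weaklyEuclidean,
      FieldFormula.orderLaws]) w ![x, y] w le_rfl
    simp only [FieldFormula.pos, KripkeStructure.forces_neg,
      KripkeStructure.Forces, toKripke,
      AtomHolds, MvPolynomial.aeval_X, K.map_refl, map_neg, map_add] at this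
    exact this ⟨hx, fun w' h => by simpa using hy w' h⟩
  exists_sqrt w x hx := by
    have := hK FieldFormula.sqrtNonneg (by simp [FieldFormula.weaklyEuclidean,
      FieldFormula.orderLaws]) w ![x, x] w le_rfl
    simp only [FieldFormula.pos, FieldFormula.eq, KripkeStructure.forces_neg,
      KripkeStructure.Forces, toKripke,
      AtomHolds, MvPolynomial.aeval_X, K.map_refl, map_neg, map_mul] at this
    exact this (fun w' h => by simpa using hx w' h)

theorem Nonneg.map {w w' : W} {x : K.F w} (hx : K.Nonneg w x) (h : w ≤ w') :
    K.Nonneg w' (K.map h x) := fun w'' h' => by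
  rw [K.map_map]; exact hx w'' _

/-! ### Signs at later nodes, and homomorphisms to ordered rings -/

namespace IsWeaklyEuclidean

variable (hK : K.IsWeaklyEuclidean)
include hK

theorem not_pos_zero (w : W) : ¬ K.Pos w 0 := fun h =>
  hK.not_pos_neg w 0 h (by simpa using h)

theorem nonneg_of_pos {w : W} {x : K.F w} (hx : K.Pos w x) : K.Nonneg w x :=
  fun w' h => hK.not_pos_neg w' _ (K.pos_map h x hx)

/-- If `x` and `-x` never become positive, both are nonnegative, so `x` is already zero at `w`. -/
theorem exists_sign {w : W} (x : K.F w) : ∃ (w' : W) (h : w ≤ w'),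
    K.Pos w' (K.map h x) ∨ K.Pos w' (-K.map h x) ∨ K.map h x = 0 := by
  by_contra! hn
  refine (hn w le_rfl).2.2 ?_
  rw [K.map_refl]
  exact hK.eq_zero w x (fun w' h => (hn w' h).2.1)
    (fun w' h => by simpa using (hn w' h).1)

/-- If `w ≤ w'`, then there is a homomorphism from the ring at `w` to a linearly ordered ring that
preserves `≥ 0` and sends the elements that have become positive at `w'` to positive elements.  The
target is a quotient by the elements that vanish eventually along an ultrafilter of nodes that
contains every dense upper set of nodes above `w'`. -/
theorem exists_orderedHom (w w' : W) (hw : w ≤ w') :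
    ∃ (R : Type u) (_ : CommRing R) (_ : LinearOrder R) (_ : IsStrictOrderedRing R)
      (φ : K.F w →+* R), (∀ y, K.Nonneg w y → 0 ≤ φ y) ∧
        (∀ y, K.Pos w' (K.map hw y) → 0 < φ y) := by
  classical
  let I := {v : W // w' ≤ v}
  -- Dense upper sets are closed under intersection: move first into `D`, then on into `E`; upward
  -- closure keeps the node in `D`.
  let L : Filter I :=
    { sets := {S | ∃ D ⊆ S, (∀ v v' : I, v.1 ≤ v'.1 → v ∈ D → v' ∈ D) ∧
        ∀ v : I, ∃ v' ∈ D, v.1 ≤ v'.1}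
      univ_sets := ⟨Set.univ, subset_rfl, by simp, fun v => ⟨v, by simp⟩⟩
      sets_of_superset := by
        rintro S T ⟨D, hD, h⟩ hST
        exact ⟨D, hD.trans hST, h⟩
      inter_sets := by
        rintro S T ⟨D, hD, h1, h2⟩ ⟨E, hE, h3, h4⟩
        refine ⟨D ∩ E, Set.inter_subset_inter hD hE,
          fun v v' h hv => ⟨h1 v v' h hv.1, h3 v v' h hv.2⟩, fun v => ?_⟩
        obtain ⟨v1, hv1, l1⟩ := h2 v
        obtain ⟨v2, hv2, l2⟩ := h4 v1
        exact ⟨v2, ⟨h1 _ _ l2 hv1, hv2⟩, l1.trans l2⟩ }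
  have hL : L.NeBot := by
    refine ⟨fun hb => ?_⟩
    have : (∅ : Set I) ∈ L := by rw [hb]; trivial
    obtain ⟨D, hD, -, h⟩ := this
    obtain ⟨v, hv, -⟩ := h ⟨w', le_rfl⟩
    exact hD hv
  let U : Ultrafilter I := Ultrafilter.of L
  have hU : (U : Filter I) ≤ L := Ultrafilter.of_le L
  let f (v : I) : K.F w →+* K.F v.1 := K.map (hw.trans v.2)
  let PP (x : K.F w) : Prop := ∀ᶠ v in (U : Filter I), K.Pos v.1 (f v x)
  let ZZ (x : K.F w) : Prop := ∀ᶠ v in (U : Filter I), f v x = 0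
  -- The nodes at which the sign of `x` is decided form a dense upper set, and an ultrafilter that
  -- contains a union of three sets contains one of them.
  have tri (x : K.F w) : PP x ∨ PP (-x) ∨ ZZ x := by
    simp only [PP, ZZ, ← Ultrafilter.eventually_or]
    refine hU ⟨_, subset_rfl, ?_, fun v => ?_⟩
    · intro v v' h hv
      have e (y) : f v' y = K.map h (f v y) := (K.map_map _ _ _).symm
      simp only [Set.mem_ofPred_eq, e] at hv ⊢
      rcases hv with hv | hv | hv
      · exact .inl (K.pos_map h _ hv)
      · exact .inr (.inl (K.pos_map h _ hv))
      · exact .inr (.inr (by rw [hv, map_zero]))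
    · obtain ⟨v', h, hv⟩ := hK.exists_sign (f v x)
      exact ⟨⟨v', v.2.trans h⟩, by simpa [f, K.map_map] using hv, h⟩
  have pz {x} (h : PP x) (h' : ZZ x) : False := by
    obtain ⟨v, hv, hv'⟩ := (h.and h').exists
    rw [hv'] at hv
    exact hK.not_pos_zero _ hv
  have pn {x} (h : PP x) (h' : PP (-x)) : False := by
    obtain ⟨v, hv, hv'⟩ := (h.and h').exists
    rw [map_neg] at hv'
    exact hK.not_pos_neg _ _ hv hv'
  have pmul {x y} (h : PP x) (h' : PP y) : PP (x * y) := by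
    filter_upwards [h, h'] with v hv hv'
    rw [map_mul]
    exact hK.mul _ _ _ hv hv'
  have padd {x y} (h : PP x) (h' : PP y) : PP (x + y) := by
    filter_upwards [h, h'] with v hv hv'
    rw [map_add]
    exact hK.add _ _ _ hv hv'
  have zadd {x y} (h : ZZ x) (h' : ZZ y) : ZZ (x + y) := by
    filter_upwards [h, h'] with v hv hv'
    rw [map_add, hv, hv', add_zero]
  have zmul {x} (c) (h : ZZ x) : ZZ (c * x) := by
    filter_upwards [h] with v hv
    rw [map_mul, hv, mul_zero]
  have zneg {x} (h : ZZ x) : ZZ (-x) := by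
    filter_upwards [h] with v hv
    rw [map_neg, hv, neg_zero]
  have pzadd {x y} (h : PP x) (h' : ZZ y) : PP (x + y) := by
    filter_upwards [h, h'] with v hv hv'
    rwa [map_add, hv', add_zero]
  have p1 : PP 1 := by
    refine Filter.Eventually.of_forall fun v => ?_
    rw [map_one]
    exact hK.one _
  let J : Ideal (K.F w) :=
    { carrier := {x | ZZ x}
      zero_mem' := Filter.Eventually.of_forall fun v => map_zero _
      add_mem' := fun h h' => zadd h h'
      smul_mem' := fun c x h => zmul c h }
  have memJ (x) : Ideal.Quotient.mk J x = 0 ↔ ZZ x := Ideal.Quotient.eq_zero_iff_mem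
  let π := Ideal.Quotient.mk J
  -- By trichotomy, if neither factor is eventually zero, then the product or its negative is
  -- eventually positive.
  have hJ : J.IsPrime := by
    refine ⟨fun h => ?_, ?_⟩
    · have : (1 : K.F w) ∈ J := by rw [h]; trivial
      exact pz p1 this
    · intro x y hxy
      change ZZ x ∨ ZZ y
      change ZZ (x * y) at hxy
      rcases tri x with hx | hx | hx
      · rcases tri y with hy | hy | hy
        · exact (pz (pmul hx hy) hxy).elim
        · exact (pz (pmul hx hy) (by simpa using zneg hxy)).elim
        · exact .inr hy
      · rcases tri y with hy | hy | hy
        · exact (pz (pmul hx hy) (by simpa using zneg hxy)).elim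
        · exact (pz (pmul hx hy) (by simpa using hxy)).elim
        · exact .inr hy
      · exact .inl hx
  -- The cone is zero together with the classes of eventually positive elements; `tri` makes the
  -- resulting order linear, and primality of `J` makes it strict.
  let C : RingCone (K.F w ⧸ J) :=
    { carrier := {q | q = 0 ∨ ∃ x, π x = q ∧ PP x}
      zero_mem' := .inl rfl
      one_mem' := .inr ⟨1, map_one _, p1⟩
      add_mem' := by
        rintro a b (rfl | ⟨x, rfl, hx⟩) (rfl | ⟨y, rfl, hy⟩)
        · exact .inl (add_zero _)
        · exact .inr ⟨y, by simp, hy⟩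
        · exact .inr ⟨x, by simp, hx⟩
        · exact .inr ⟨x + y, by simp, padd hx hy⟩
      mul_mem' := by
        rintro a b (rfl | ⟨x, rfl, hx⟩) (rfl | ⟨y, rfl, hy⟩)
        · exact .inl (mul_zero _)
        · exact .inl (zero_mul _)
        · exact .inl (mul_zero _)
        · exact .inr ⟨x * y, by simp, pmul hx hy⟩
      eq_zero_of_mem_of_neg_mem' := by
        rintro a (rfl | ⟨x, rfl, hx⟩) h
        · rfl
        · rcases h with h | ⟨y, hy, hy'⟩
          · simpa using h
          · have : ZZ (y + x) := (memJ _).1 (by rw [map_add]; exact (eq_neg_iff_add_eq_zero.1 hy))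
            exact (pz (padd hy' hx) this).elim }
  have : HasMemOrNegMem C := ⟨by
    intro a
    obtain ⟨x, rfl⟩ := Ideal.Quotient.mk_surjective a
    rcases tri x with hx | hx | hx
    · exact .inl (.inr ⟨x, rfl, hx⟩)
    · exact .inr (.inr ⟨-x, map_neg _ _, hx⟩)
    · exact .inl (.inl ((memJ x).2 hx))⟩
  let lo : LinearOrder (K.F w ⧸ J) := LinearOrder.mkOfAddGroupCone C
  have : IsOrderedRing (K.F w ⧸ J) := IsOrderedRing.mkOfCone C
  have : IsDomain (K.F w ⧸ J) := (Ideal.Quotient.isDomain_iff_prime J).2 hJ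
  have hpos {x} (hx : PP x) : 0 < π x := by
    refine lt_of_le_of_ne ?_ ?_
    · change π x - 0 ∈ C
      rw [sub_zero]
      exact .inr ⟨x, rfl, hx⟩
    · intro h
      exact pz hx ((memJ x).1 h.symm)
  refine ⟨K.F w ⧸ J, inferInstance, lo, inferInstance, π, ?_, ?_⟩
  · intro y hy
    rcases tri y with h | h | h
    · exact (hpos h).le
    -- An eventually positive `-y` would be positive at an actual node above `w`, against `y ≥ 0` at
    -- `w`.
    · obtain ⟨v, hv⟩ := h.exists
      rw [map_neg] at hv
      exact (hy _ _ hv).elim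
    · exact ((memJ y).2 h).ge
  · intro y hy
    apply hpos
    refine Filter.Eventually.of_forall fun v => ?_
    have := K.pos_map v.2 _ hy
    rwa [K.map_map] at this

end IsWeaklyEuclidean
end OrderedKripkeRing

/-! ### Plane geometry over a single ring -/

/-- The properties of the ring at one node of a Kripke model of the axioms of weakly Euclidean
fields, where `P` is positivity and `N` is nonnegativity, both as forced at that node. -/
structure IsPositivity {F : Type u} [CommRing F] (P N : F → Prop) : Prop where
  exists_inv : ∀ x, P x → ∃ y, x * y = 1 ∧ P y
  add : ∀ {x y}, P x → P y → P (x + y)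
  mul : ∀ {x y}, P x → P y → P (x * y)
  one : P 1
  add_nonneg : ∀ {x y}, P x → N y → P (x + y)
  exists_sqrt : ∀ x, N x → ∃ z, N z ∧ z * z = x
  not_pos_zero : ¬ P 0
  eq_zero : ∀ x, N x → N (-x) → x = 0
  nonneg_of_hom : ∀ x, (∀ (R : Type u) [CommRing R] [LinearOrder R] [IsStrictOrderedRing R]
    (φ : F →+* R), (∀ y, N y → 0 ≤ φ y) → (∀ y, P y → 0 < φ y) → 0 ≤ φ x) → N x

/-- Only `nonneg_of_hom` looks at other nodes: if `-x` were positive at `w'`, the homomorphism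
chosen for `w'` would send `x` to a negative element. -/
theorem OrderedKripkeRing.IsWeaklyEuclidean.isPositivity {W : Type v} [Preorder W]
    {K : OrderedKripkeRing.{u, v} W} (hK : K.IsWeaklyEuclidean) (w : W) :
    IsPositivity (K.Pos w) (K.Nonneg w) where
  exists_inv := hK.exists_inv w
  add := hK.add w _ _
  mul := hK.mul w _ _
  one := hK.one w
  add_nonneg := hK.add_nonneg w _ _
  exists_sqrt := hK.exists_sqrt w
  not_pos_zero := hK.not_pos_zero w
  eq_zero := hK.eq_zero w
  nonneg_of_hom x hx w' h hpos := by
    obtain ⟨R, _, _, _, φ, h1, h2⟩ := hK.exists_orderedHom w w' h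
    have h3 := hx R φ h1 fun y hy => h2 y (K.pos_map h y hy)
    have h4 := h2 (-x) (by simpa using hpos)
    rw [map_neg] at h4
    linarith

/-! ### Order algebra at one node -/

namespace IsPositivity

variable {F : Type u} [CommRing F] {P N : F → Prop} (h : IsPositivity P N)
include h

theorem nonneg_of_pos {x : F} (hx : P x) : N x :=
  h.nonneg_of_hom _ fun _ _ _ _ _ _ hP => (hP x hx).le

theorem eq_of_hom (x y : F) (H : ∀ (R : Type u) [CommRing R] [LinearOrder R] [IsStrictOrderedRing R]
    (φ : F →+* R), (∀ y, N y → 0 ≤ φ y) → (∀ y, P y → 0 < φ y) → φ x = φ y) : x = y := by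
  rw [← sub_eq_zero]
  refine h.eq_zero _ (h.nonneg_of_hom _ ?_) (h.nonneg_of_hom _ ?_) <;>
  · intro R _ _ _ φ hN hP
    simp [H R φ hN hP]

theorem pos_mono {x y : F} (hx : P x) (hy : N (y - x)) : P y := by
  simpa using h.add_nonneg hx hy

theorem nonneg_mul {x y : F} (hx : N x) (hy : N y) : N (x * y) :=
  h.nonneg_of_hom _ fun _ _ _ _ φ hN _ => by
    rw [map_mul]; exact mul_nonneg (hN x hx) (hN y hy)

/-- Since `y` need not be invertible, divide by `1 + y` instead: `x` exceeds the positive element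
`xy/(1+y)` by `x/(1+y) ≥ 0`. This is the substitute for Markov's principle throughout. -/
theorem pos_of_mul {x y : F} (hxy : P (x * y)) (hx : N x) (hy : N y) : P x := by
  obtain ⟨i, hi, hip⟩ := h.exists_inv (1 + y) (h.add_nonneg h.one hy)
  refine h.pos_mono (h.mul hxy hip) ?_
  have : x - x * y * i = x * i := by linear_combination (-x) * hi
  rw [this]
  exact h.nonneg_mul hx (h.nonneg_of_pos hip)

theorem pos_of_mul_pos {x y : F} (hxy : P (x * y)) (hx : P x) : P y := by
  obtain ⟨i, hi, hip⟩ := h.exists_inv x hx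
  have := h.mul hip hxy
  rwa [← mul_assoc, mul_comm i x, hi, one_mul] at this

theorem exists_sqrt_pos {x : F} (hx : P x) : ∃ z, P z ∧ z * z = x := by
  obtain ⟨z, hz, rfl⟩ := h.exists_sqrt x (h.nonneg_of_pos hx)
  exact ⟨z, h.pos_of_mul hx hz hz, rfl⟩

theorem eq_of_mul_self_eq {x y : F} (hx : N x) (hy : N y) (hxy : x * x = y * y) : x = y :=
  h.eq_of_hom _ _ fun R _ _ _ φ hN _ => by
    have := congrArg φ hxy
    rw [map_mul, map_mul] at this
    exact (mul_self_inj (hN x hx) (hN y hy)).1 this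

theorem pos_natCast (n : ℕ) : P (n + 1 : F) := by
  induction n with
  | zero => simpa using h.one
  | succ n ih => push_cast; exact h.add ih h.one

theorem dot_self_nonneg (x : F × F) : N (dot x x) :=
  h.nonneg_of_hom _ fun _ _ _ _ φ _ _ => by
    simp only [dot, map_add, map_mul]
    exact _root_.add_nonneg (mul_self_nonneg _) (mul_self_nonneg _)

theorem dot_self_eq_zero {x : F × F} (hx : dot x x = 0) : x = 0 := by
  have key (R : Type u) [CommRing R] [LinearOrder R] [IsStrictOrderedRing R] (φ : F →+* R) :
      φ x.1 = 0 ∧ φ x.2 = 0 := by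
    have := congrArg φ hx
    simp only [dot, map_add, map_mul, map_zero] at this
    exact mul_self_add_mul_self_eq_zero.1 this
  refine Prod.ext (h.eq_of_hom _ _ ?_) (h.eq_of_hom _ _ ?_)
  · intro R _ _ _ φ _ _
    simp [(key R φ).1]
  · intro R _ _ _ φ _ _
    simp [(key R φ).2]

theorem pos_dot_self_of_mul {x y : F × F} (hxy : P (dot x x * dot y y)) :
    P (dot x x) ∧ P (dot y y) :=
  ⟨h.pos_of_mul hxy (h.dot_self_nonneg _) (h.dot_self_nonneg _),
    h.pos_of_mul (by rwa [mul_comm]) (h.dot_self_nonneg _) (h.dot_self_nonneg _)⟩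

/-- Lagrange's identity: `|x|²|y|²` exceeds the squared cross product by the square of the dot
product. -/
theorem pos_dot_self_of_cross {x y : F × F} (hxy : P (cross x y * cross x y)) :
    P (dot x x) ∧ P (dot y y) := by
  refine h.pos_dot_self_of_mul (h.pos_mono hxy (h.nonneg_of_hom _ fun _ _ _ _ φ _ _ => ?_))
  have : dot x x * dot y y - cross x y * cross x y = dot x y * dot x y := by
    simp only [dot, cross]; ring
  rw [this, map_mul]
  exact mul_self_nonneg _

theorem pos_dot_self_of_dot {x y : F × F} (hxy : P (dot x y * dot x y)) :
    P (dot x x) ∧ P (dot y y) := by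
  refine h.pos_dot_self_of_mul (h.pos_mono hxy (h.nonneg_of_hom _ fun _ _ _ _ φ _ _ => ?_))
  have : dot x x * dot y y - dot x y * dot x y = cross x y * cross x y := by
    simp only [dot, cross]; ring
  rw [this, map_mul]
  exact mul_self_nonneg _

/-- The coefficient is that of the orthogonal projection, `t = x·y / |x|²`. -/
theorem exists_smul_of_cross {x y : F × F} (hx : P (dot x x)) (hxy : cross x y = 0) :
    ∃ t, y = t • x ∧ t * dot x x = dot x y := by
  obtain ⟨i, hi, hip⟩ := h.exists_inv _ hx
  simp only [dot, cross] at hi hxy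
  refine ⟨dot x y * i, Prod.ext ?_ ?_, ?_⟩
  · simp only [dot, Prod.smul_fst, smul_eq_mul]
    linear_combination (-y.1) * hi - x.2 * i * hxy
  · simp only [dot, Prod.smul_snd, smul_eq_mul]
    linear_combination (-y.2) * hi + x.1 * i * hxy
  · simp only [dot]
    linear_combination (x.1 * y.1 + x.2 * y.2) * hi

end IsPositivity

/-- Strict betweenness in the plane over a ring, where `P` is positivity. -/
def Btw {F : Type u} [CommRing F] (P : F → Prop) (a b c : F × F) : Prop :=
  cross (c - b) (b - a) = 0 ∧ P (dot (b - c) (a - b))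

/-- Squared distance. -/
def distSq {F : Type u} [CommRing F] (a b : F × F) : F := dot (b - a) (b - a)

section Identities

variable {F : Type u} [CommRing F]

theorem distSq_comm (a b : F × F) : distSq a b = distSq b a := by
  simp only [distSq, dot, Prod.fst_sub, Prod.snd_sub]; ring

theorem dot_comm (a b : F × F) : dot a b = dot b a := by
  simp only [dot]; ring

theorem pos_distSq_comm {P : F → Prop} {a b : F × F} (H : P (distSq a b)) : P (distSq b a) :=
  distSq_comm a b ▸ H

theorem dot_smul_smul (t : F) (x : F × F) : dot (t • x) (t • x) = t * t * dot x x := by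
  simp only [dot, Prod.smul_fst, Prod.smul_snd, smul_eq_mul]; ring

theorem cross_add_smul_sub (a x : F × F) (s t : F) :
    cross (a + t • x - a) (a - (a + s • x)) = 0 := by
  simp only [cross, Prod.fst_sub, Prod.snd_sub, Prod.fst_add, Prod.snd_add, Prod.smul_fst,
    Prod.smul_snd, smul_eq_mul]
  ring

theorem Btw.symm {P : F → Prop} {a b c : F × F} (H : Btw P a b c) : Btw P c b a := by
  refine ⟨?_, ?_⟩
  · have := H.1
    simp only [cross, Prod.fst_sub, Prod.snd_sub] at this ⊢
    linear_combination -this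
  · convert H.2 using 1
    simp only [dot, Prod.fst_sub, Prod.snd_sub]; ring

end Identities

/-! ### Betweenness by parameters -/

namespace IsPositivity

variable {F : Type u} [CommRing F] {P N : F → Prop} (h : IsPositivity P N)
include h

/-- A positive dot product makes `a` and `b` apart by Cauchy-Schwarz, so one can divide by `|ab|²`
to find the parameter. -/
theorem btw_iff_extend {a b c : F × F} :
    Btw P a b c ↔ P (distSq a b) ∧ ∃ t, P t ∧ c = b + t • (b - a) := by
  constructor
  · rintro ⟨h1, h2⟩
    have h3 : dot (b - c) (a - b) = dot (b - a) (c - b) := by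
      simp only [dot, Prod.fst_sub, Prod.snd_sub]; ring
    rw [h3] at h2
    have h4 := (h.pos_dot_self_of_dot (h.mul h2 h2)).1
    have h5 : cross (b - a) (c - b) = 0 := by
      simp only [cross, Prod.fst_sub, Prod.snd_sub] at h1 ⊢
      linear_combination -h1
    obtain ⟨t, ht, ht'⟩ := h.exists_smul_of_cross h4 h5
    refine ⟨h4, t, ?_, by rw [← ht]; abel⟩
    rw [← ht', mul_comm] at h2
    exact h.pos_of_mul_pos h2 h4
  · rintro ⟨h1, t, ht, rfl⟩
    refine ⟨?_, ?_⟩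
    · simp only [cross, Prod.fst_sub, Prod.snd_sub, Prod.fst_add, Prod.snd_add, Prod.smul_fst,
        Prod.smul_snd, smul_eq_mul]
      ring
    · convert h.mul ht h1 using 1
      simp only [distSq, dot, Prod.fst_sub, Prod.snd_sub, Prod.fst_add, Prod.snd_add, Prod.smul_fst,
        Prod.smul_snd, smul_eq_mul]
      ring

theorem btw_iff_convex {a b c : F × F} :
    Btw P a b c ↔ P (distSq a c) ∧ ∃ t, P t ∧ P (1 - t) ∧ b = a + t • (c - a) := by
  constructor
  · intro H
    obtain ⟨h1, s, hs, rfl⟩ := h.btw_iff_extend.1 H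
    have hs1 := h.add h.one hs
    -- If `c = b + s(b - a)`, then `b` divides `ac` at the ratio `1/(1+s)`.
    obtain ⟨i, hi, hip⟩ := h.exists_inv _ hs1
    refine ⟨?_, i, hip, ?_, ?_⟩
    · convert h.mul (h.mul hs1 hs1) h1 using 1
      simp only [distSq, dot, Prod.fst_sub, Prod.snd_sub, Prod.fst_add, Prod.snd_add, Prod.smul_fst,
        Prod.smul_snd, smul_eq_mul]
      ring
    · convert h.mul hs hip using 1
      linear_combination -hi
    · ext <;> simp only [Prod.fst_sub, Prod.snd_sub, Prod.fst_add, Prod.snd_add, Prod.smul_fst,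
        Prod.smul_snd, smul_eq_mul]
      · linear_combination (a.1 - b.1) * hi
      · linear_combination (a.2 - b.2) * hi
  · rintro ⟨h1, t, ht, ht', rfl⟩
    refine ⟨?_, ?_⟩
    · simp only [cross, Prod.fst_sub, Prod.snd_sub, Prod.fst_add, Prod.snd_add, Prod.smul_fst,
        Prod.smul_snd, smul_eq_mul]
      ring
    · convert h.mul (h.mul ht ht') h1 using 1
      simp only [distSq, dot, Prod.fst_sub, Prod.snd_sub, Prod.fst_add, Prod.snd_add, Prod.smul_fst,
        Prod.smul_snd, smul_eq_mul]
      ring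

theorem exists_btw_iff {a b : F × F} :
    (∃ c, Btw P c a b ∨ Btw P a c b ∨ Btw P a b c) ↔ P (distSq a b) := by
  constructor
  · rintro ⟨c, H | H | H⟩
    · rw [distSq_comm]; exact (h.btw_iff_extend.1 H.symm).1
    · exact (h.btw_iff_convex.1 H).1
    · exact (h.btw_iff_extend.1 H).1
  · exact fun H => ⟨_, .inr (.inr (h.btw_iff_extend.2 ⟨H, 1, h.one, rfl⟩))⟩

/-- A point on the open ray from `a` through `b`. -/
theorem smul_of_ray {a b x d : F × F} (h1 : Btw P d a b) (h2 : Btw P d a x) :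
    P (distSq a b) ∧ ∃ t, P t ∧ x - a = t • (b - a) := by
  refine ⟨by rw [distSq_comm]; exact (h.btw_iff_extend.1 h1.symm).1, ?_⟩
  obtain ⟨-, t, ht, rfl⟩ := h.btw_iff_extend.1 h1
  obtain ⟨-, s, hs, rfl⟩ := h.btw_iff_extend.1 h2
  obtain ⟨i, hi, hip⟩ := h.exists_inv _ ht
  refine ⟨s * i, h.mul hs hip, ?_⟩
  ext <;> simp only [Prod.fst_sub, Prod.snd_sub, Prod.fst_add, Prod.snd_add, Prod.smul_fst,
        Prod.smul_snd, smul_eq_mul]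
  · linear_combination (-(s * (a.1 - d.1))) * hi
  · linear_combination (-(s * (a.2 - d.2))) * hi

theorem btw_trans_inner {a b c d : F × F} (h1 : Btw P a b d) (h2 : Btw P b c d) : Btw P a b c := by
  obtain ⟨h3, t, ht, rfl⟩ := h.btw_iff_extend.1 h1
  obtain ⟨-, s, hs, -, rfl⟩ := h.btw_iff_convex.1 h2
  refine h.btw_iff_extend.2 ⟨h3, s * t, h.mul hs ht, ?_⟩
  ext <;> simp <;> ring

end IsPositivity

/-! ### Angles over a single ring -/

/-- The angle `abc` has cosine smaller than `1`, in terms of the lengths of its legs. -/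
def AngPos {F : Type u} [CommRing F] (P : F → Prop) (a b c : F × F) : Prop :=
  P (distSq b a) ∧ P (distSq b c) ∧ ∀ x y, P x → P y → x * x = distSq b a → y * y = distSq b c →
    P (x * y - dot (a - b) (c - b))

namespace IsPositivity

variable {F : Type u} [CommRing F] {P N : F → Prop} (h : IsPositivity P N)
include h

theorem dot_le_mul {A C : F × F} {x y : F} (hx : N x) (hy : N y) (hxA : x * x = dot A A)
    (hyC : y * y = dot C C) : N (x * y - dot A C) :=
  h.nonneg_of_hom _ fun R _ _ _ φ hN _ => by
    have e1 := congrArg φ hxA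
    have e2 := congrArg φ hyC
    simp only [dot, map_add, map_mul, map_sub] at e1 e2 ⊢
    have : (φ A.1 * φ C.1 + φ A.2 * φ C.2) ^ 2 ≤ (φ x * φ y) ^ 2 := by
      have e3 : (φ x * φ y) ^ 2 = (φ x * φ x) * (φ y * φ y) := by ring
      rw [e3, e1, e2]
      nlinarith [sq_nonneg (φ A.1 * φ C.2 - φ A.2 * φ C.1)]
    have := (le_abs_self _).trans (abs_le_of_sq_le_sq this (mul_nonneg (hN x hx) (hN y hy)))
    linarith

/-- With equal legs `tx = sy`, the law of cosines gives `|sC - tA|² = 2ts(xy - A·C)` for the base of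
the isosceles triangle. -/
theorem pos_mul_sub_dot_of_apex {A C : F × F} {t s x y : F} (ht : P t) (hs : P s)
    (hx : P x) (hy : P y) (hxA : x * x = dot A A) (hyC : y * y = dot C C)
    (e : t * t * dot A A = s * s * dot C C) (hp : P (dot (s • C - t • A) (s • C - t • A))) :
    P (x * y - dot A C) := by
  have e1 : t * x = s * y := by
    refine h.eq_of_mul_self_eq (h.nonneg_of_pos (h.mul ht hx)) (h.nonneg_of_pos (h.mul hs hy)) ?_
    linear_combination t * t * hxA + e - s * s * hyC
  have hN := h.dot_le_mul (h.nonneg_of_pos hx) (h.nonneg_of_pos hy) hxA hyC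
  have hp2 : P ((x * y - dot A C) * ((1 + 1) * (t * s))) := by
    convert hp using 1
    simp only [dot, Prod.fst_sub, Prod.snd_sub, Prod.smul_fst, Prod.smul_snd, smul_eq_mul]
      at hxA hyC ⊢
    linear_combination (-(t * x) + s * y) * e1 + t * t * hxA + s * s * hyC
  exact h.pos_of_mul hp2 hN (h.nonneg_of_pos (h.mul (h.add h.one h.one) (h.mul ht hs)))

/-- The two triangles have equal sides, so the law of cosines gives `ts(xy - A·C) = t's'(x'y' -
A'·C')`. -/
theorem pos_mul_sub_dot_of_congr {A C A' C' : F × F} {t s t' s' x y : F}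
    (ht : P t) (hs : P s) (ht' : P t') (hs' : P s') (hx : P x) (hy : P y)
    (hxA : x * x = dot A A) (hyC : y * y = dot C C)
    (hA' : P (dot A' A')) (hC' : P (dot C' C'))
    (H : ∀ x' y', P x' → P y' → x' * x' = dot A' A' → y' * y' = dot C' C' →
      P (x' * y' - dot A' C'))
    (e1 : t * t * dot A A = t' * t' * dot A' A') (e2 : s * s * dot C C = s' * s' * dot C' C')
    (e3 : dot (s • C - t • A) (s • C - t • A) = dot (s' • C' - t' • A') (s' • C' - t' • A')) :
    P (x * y - dot A C) := by
  obtain ⟨x', hx', hxA'⟩ := h.exists_sqrt_pos hA'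
  obtain ⟨y', hy', hyC'⟩ := h.exists_sqrt_pos hC'
  have f1 : t * x = t' * x' := by
    refine h.eq_of_mul_self_eq (h.nonneg_of_pos (h.mul ht hx)) (h.nonneg_of_pos (h.mul ht' hx')) ?_
    linear_combination t * t * hxA + e1 - t' * t' * hxA'
  have f2 : s * y = s' * y' := by
    refine h.eq_of_mul_self_eq (h.nonneg_of_pos (h.mul hs hy)) (h.nonneg_of_pos (h.mul hs' hy')) ?_
    linear_combination s * s * hyC + e2 - s' * s' * hyC'
  have two := h.add h.one h.one
  refine h.pos_of_mul_pos (x := (1 + 1) * (t * s)) ?_ (h.mul two (h.mul ht hs))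
  convert h.mul (h.mul two (h.mul ht' hs')) (H x' y' hx' hy' hxA' hyC') using 1
  simp only [dot, Prod.fst_sub, Prod.snd_sub, Prod.smul_fst, Prod.smul_snd, smul_eq_mul]
    at e1 e2 e3 ⊢
  linear_combination (1 + 1) * s * y * f1 + (1 + 1) * t' * x' * f2 - e1 - e2 + e3

/-- Orthogonality gives `A·C = x²`, hence `xy - A·C = x(y - x)`. By Pythagoras `(y - x)(y + x) = |C
- A|² > 0`; nonnegativity of `y - x` comes from ordered rings, its positivity from `pos_of_mul`. -/
theorem pos_mul_sub_dot_of_right {A C : F × F} {x y : F} (hx : P x) (hy : P y)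
    (hxA : x * x = dot A A) (hyC : y * y = dot C C) (e : dot A (C - A) = 0)
    (hp : P (dot (C - A) (C - A))) : P (x * y - dot A C) := by
  have hN : N (y - x) := h.nonneg_of_hom _ fun R _ _ _ φ hN hP => by
    have e1 : y * y - x * x = dot (C - A) (C - A) := by
      simp only [dot, Prod.fst_sub, Prod.snd_sub] at *
      linear_combination hyC - hxA + 2 * e
    have e2 := hP _ (e1 ▸ hp)
    rw [map_sub, map_mul, map_mul] at e2
    rw [map_sub]
    nlinarith [hP _ hx, hP _ hy]
  have hp1 : P ((y - x) * (y + x)) := by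
    convert hp using 1
    simp only [dot, Prod.fst_sub, Prod.snd_sub] at *
    linear_combination hyC - hxA + 2 * e
  have hp2 := h.pos_of_mul hp1 hN (h.nonneg_of_pos (h.add hy hx))
  convert h.mul hx hp2 using 1
  simp only [dot, Prod.fst_sub, Prod.snd_sub] at *
  linear_combination hxA - e

theorem angPos_of_apex {a b c u v d e : F × F} (hu : Btw P d b a ∧ Btw P d b u)
    (hv : Btw P e b c ∧ Btw P e b v) (huv : distSq b u = distSq b v) (hd : P (distSq u v)) :
    AngPos P a b c := by
  obtain ⟨h1, t, ht, e1⟩ := h.smul_of_ray hu.1 hu.2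
  obtain ⟨h2, s, hs, e2⟩ := h.smul_of_ray hv.1 hv.2
  refine ⟨h1, h2, fun x y hx hy hxa hyc => ?_⟩
  refine h.pos_mul_sub_dot_of_apex ht hs hx hy hxa hyc ?_ ?_
  · rw [← dot_smul_smul, ← dot_smul_smul, ← e1, ← e2]; exact huv
  · rw [← e1, ← e2, sub_sub_sub_cancel_right]; exact hd

/-- The right angles of EG: if `b` is the midpoint of `ad` and `ac = dc`, then `ab ⊥ bc`. -/
theorem dot_eq_zero_of_right {a b c d : F × F} (h1 : Btw P a b d) (h2 : distSq a b = distSq b d)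
    (h3 : distSq a c = distSq d c) : P (distSq b a) ∧ dot (a - b) (c - b) = 0 := by
  obtain ⟨hp, t, ht, rfl⟩ := h.btw_iff_extend.1 h1
  obtain ⟨i, hi, -⟩ := h.exists_inv _ hp
  -- Equal lengths give only `t² = 1`; nonnegativity excludes the other root.
  obtain rfl : t = 1 := by
    refine h.eq_of_mul_self_eq (h.nonneg_of_pos ht) (h.nonneg_of_pos h.one) ?_
    simp only [distSq, dot, Prod.fst_sub, Prod.snd_sub, Prod.fst_add, Prod.snd_add, Prod.smul_fst,
      Prod.smul_snd, smul_eq_mul] at h2 hi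
    linear_combination (-i) * h2 + (1 - t * t) * hi
  refine ⟨by rwa [distSq_comm], ?_⟩
  obtain ⟨j, hj, -⟩ := h.exists_inv _ (h.add (h.add h.one h.one) (h.add h.one h.one))
  simp only [distSq, dot, Prod.fst_sub, Prod.snd_sub, Prod.fst_add, Prod.snd_add, Prod.smul_fst,
      Prod.smul_snd, smul_eq_mul] at h3 ⊢
  linear_combination (-j) * h3 - ((a.1 - b.1) * (c.1 - b.1) + (a.2 - b.2) * (c.2 - b.2)) * hj

theorem angPos_of_right {a b c d : F × F} (h1 : Btw P a b d) (h2 : distSq a b = distSq b d)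
    (h3 : distSq a c = distSq d c) (h4 : P (distSq c b)) : AngPos P a b c := by
  obtain ⟨h5, h6⟩ := h.dot_eq_zero_of_right h1 h2 h3
  refine ⟨h5, by rwa [distSq_comm], fun x y hx hy _ _ => ?_⟩
  rw [h6, sub_zero]
  exact h.mul hx hy

/-- The acute angles of a right triangle are positive. -/
theorem angPos_of_right_triangle {a b c : F × F} (e : dot (b - a) (c - a) = 0)
    (hab : P (distSq a b)) (hac : P (distSq a c)) : AngPos P a b c ∧ AngPos P c b a := by
  have hbc : P (distSq b c) := by
    convert h.add hab hac using 1
    simp only [distSq, dot, Prod.fst_sub, Prod.snd_sub] at e ⊢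
    linear_combination (-2) * e
  have key {x y : F} (hx : P x) (hy : P y) (hxa : x * x = distSq b a)
      (hyc : y * y = distSq b c) : P (x * y - dot (a - b) (c - b)) := by
    refine h.pos_mul_sub_dot_of_right hx hy hxa hyc ?_ ?_
    · simp only [dot, Prod.fst_sub, Prod.snd_sub] at e ⊢
      linear_combination -e
    · rwa [sub_sub_sub_cancel_right]
  refine ⟨⟨by rwa [distSq_comm], hbc, fun x y => key⟩, hbc, by rwa [distSq_comm], ?_⟩
  intro x y hx hy hxc hya
  convert key hy hx hya hxc using 1
  simp only [dot]; ring

theorem angPos_of_congr {a b c a' b' c' u v u' v' d e d' e' : F × F}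
    (hu : Btw P d b a ∧ Btw P d b u) (hv : Btw P e b c ∧ Btw P e b v)
    (hu' : Btw P d' b' a' ∧ Btw P d' b' u') (hv' : Btw P e' b' c' ∧ Btw P e' b' v')
    (e1 : distSq b u = distSq b' u') (e2 : distSq b v = distSq b' v')
    (e3 : distSq u v = distSq u' v') (H : AngPos P a' b' c') : AngPos P a b c := by
  obtain ⟨h1, t, ht, f1⟩ := h.smul_of_ray hu.1 hu.2
  obtain ⟨h2, s, hs, f2⟩ := h.smul_of_ray hv.1 hv.2
  obtain ⟨h1', t', ht', f1'⟩ := h.smul_of_ray hu'.1 hu'.2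
  obtain ⟨h2', s', hs', f2'⟩ := h.smul_of_ray hv'.1 hv'.2
  refine ⟨h1, h2, fun x y hx hy hxa hyc => ?_⟩
  refine h.pos_mul_sub_dot_of_congr ht hs ht' hs' hx hy hxa hyc H.1 H.2.1 H.2.2 ?_ ?_ ?_
  · rw [← dot_smul_smul, ← dot_smul_smul, ← f1, ← f1']; exact e1
  · rw [← dot_smul_smul, ← dot_smul_smul, ← f2, ← f2']; exact e2
  · rw [← f1, ← f2, ← f1', ← f2', sub_sub_sub_cancel_right, sub_sub_sub_cancel_right]; exact e3

/-- With `A = a - b` and `C = c - b`, the supplementary leg is `-tA`, of length `t|A|`. So `|A||C| -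
A·C` and `|A||C| + A·C` are both positive, and their product is `(A × C)²`. -/
theorem pos_cross_of_angPos {a b c d : F × F} (h1 : AngPos P a b c) (h2 : Btw P d b a)
    (h3 : AngPos P d b c) : P (cross (a - b) (c - b) * cross (a - b) (c - b)) := by
  obtain ⟨hp, t, ht, rfl⟩ := h.btw_iff_extend.1 h2.symm
  obtain ⟨x, hx, hxa⟩ := h.exists_sqrt_pos h1.1
  obtain ⟨y, hy, hyc⟩ := h.exists_sqrt_pos h1.2.1
  have p1 := h1.2.2 x y hx hy hxa hyc
  have p2 := h3.2.2 (t * x) y (h.mul ht hx) hy (by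
    simp only [distSq, dot, Prod.fst_sub, Prod.snd_sub, Prod.fst_add, Prod.snd_add, Prod.smul_fst,
      Prod.smul_snd, smul_eq_mul] at hxa ⊢
    linear_combination t * t * hxa) hyc
  have p3 : P (x * y + dot (a - b) (c - b)) := by
    refine h.pos_of_mul_pos (x := t) ?_ ht
    convert p2 using 1
    simp only [dot, Prod.fst_sub, Prod.snd_sub, Prod.fst_add, Prod.snd_add, Prod.smul_fst,
      Prod.smul_snd, smul_eq_mul]
    ring
  convert h.mul p1 p3 using 1
  simp only [distSq, cross, dot, Prod.fst_sub, Prod.snd_sub] at hxa hyc ⊢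
  linear_combination (-(y * y)) * hxa -
    ((a.1 - b.1) * (a.1 - b.1) + (a.2 - b.2) * (a.2 - b.2)) * hyc

end IsPositivity

/-! ### The axioms of EG over a single ring -/

namespace IsPositivity

variable {F : Type u} [CommRing F] {P N : F → Prop} (h : IsPositivity P N)
include h

theorem btw_nonneg {a b c : F × F} (H : Btw P a b c) : Btw N a b c :=
  ⟨H.1, h.nonneg_of_pos H.2⟩

theorem eq_of_distSq_eq_zero {a b : F × F} (H : distSq a b = 0) : a = b :=
  (sub_eq_zero.1 (h.dot_self_eq_zero H)).symm

theorem five_segment {a b c d a' b' c' d' : F × F} (hab : P (distSq a b)) (h1 : Btw N a b c)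
    (h2 : Btw N a' b' c') (e1 : distSq a b = distSq a' b') (e2 : distSq b c = distSq b' c')
    (e3 : distSq a d = distSq a' d') (e4 : distSq b d = distSq b' d') :
    distSq c d = distSq c' d' := by
  -- Nonstrict betweenness still has a parameter, because `a` and `b` are apart; `c` may coincide
  -- with `b`.
  have key {a b c : F × F} (hab : P (distSq a b)) (H : Btw N a b c) :
      ∃ t, N t ∧ c = b + t • (b - a) := by
    obtain ⟨t, ht, ht'⟩ := h.exists_smul_of_cross (x := b - a) (y := c - b) hab (by
      have := H.1
      simp only [cross, Prod.fst_sub, Prod.snd_sub] at this ⊢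
      linear_combination -this)
    obtain ⟨i, hi, hip⟩ := h.exists_inv _ hab
    refine ⟨t, ?_, by rw [← ht]; abel⟩
    convert h.nonneg_mul (h.nonneg_of_pos hip) H.2 using 1
    simp only [distSq, dot, Prod.fst_sub, Prod.snd_sub] at ht' hi ⊢
    linear_combination i * ht' - t * hi
  obtain ⟨t, ht, rfl⟩ := key hab h1
  obtain ⟨t', ht', rfl⟩ := key (e1 ▸ hab) h2
  obtain ⟨i, hi, hip⟩ := h.exists_inv _ hab
  obtain rfl : t = t' := by
    refine h.eq_of_mul_self_eq ht ht' ?_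
    simp only [distSq, dot, Prod.fst_sub, Prod.snd_sub, Prod.fst_add, Prod.snd_add, Prod.smul_fst,
      Prod.smul_snd, smul_eq_mul] at e1 e2 hi
    linear_combination i * e2 - i * t' * t' * e1 - (t * t - t' * t') * hi
  simp only [distSq, dot, Prod.fst_sub, Prod.snd_sub, Prod.fst_add, Prod.snd_add, Prod.smul_fst,
    Prod.smul_snd, smul_eq_mul] at e1 e3 e4 ⊢
  -- Stewart's theorem: `|cd|² = (1+t)|bd|² - t|ad|² + (t+t²)|ab|²`.
  linear_combination (1 + t) * e4 - t * e3 + (t + t * t) * e1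

/-- Take `t = |cd|/|ab|`. One witness serves both extension axioms, since it is positive as soon as
`c` and `d` are apart. -/
theorem exists_extension {a b c d : F × F} (hab : P (distSq a b)) :
    ∃ t, N t ∧ (P (distSq c d) → P t) ∧ distSq b (b + t • (b - a)) = distSq c d := by
  obtain ⟨x, hx, hxa⟩ := h.exists_sqrt_pos hab
  obtain ⟨y, hy, hyc⟩ := h.exists_sqrt (distSq c d) (h.dot_self_nonneg _)
  obtain ⟨i, hi, hip⟩ := h.exists_inv _ hx
  refine ⟨y * i, h.nonneg_mul hy (h.nonneg_of_pos hip), fun hp => ?_, ?_⟩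
  · rw [← hyc] at hp
    exact h.mul (h.pos_of_mul hp hy hy) hip
  · have : distSq b (b + (y * i) • (b - a)) = (y * i) * (y * i) * distSq a b := by
      simp only [distSq, dot, Prod.fst_sub, Prod.snd_sub, Prod.fst_add, Prod.snd_add, Prod.smul_fst,
        Prod.smul_snd, smul_eq_mul]
      ring
    rw [this, ← hxa, ← hyc]
    linear_combination y * y * (x * i + 1) * hi

theorem weak_extension {a b c d : F × F} (hab : P (distSq a b)) :
    ∃ e, Btw N a b e ∧ distSq b e = distSq c d := by
  obtain ⟨t, ht, -, e⟩ := h.exists_extension (b := b) (c := c) (d := d) hab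
  refine ⟨_, ⟨?_, ?_⟩, e⟩
  · simp only [cross, Prod.fst_sub, Prod.snd_sub, Prod.fst_add, Prod.snd_add, Prod.smul_fst,
      Prod.smul_snd, smul_eq_mul]
    ring
  · convert h.nonneg_mul ht (h.nonneg_of_pos hab) using 1
    simp only [distSq, dot, Prod.fst_sub, Prod.snd_sub, Prod.fst_add, Prod.snd_add, Prod.smul_fst,
      Prod.smul_snd, smul_eq_mul]
    ring

theorem strict_extension {a b c d : F × F} (hab : P (distSq a b)) (hcd : P (distSq c d)) :
    ∃ e, Btw P a b e ∧ distSq b e = distSq c d := by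
  obtain ⟨t, -, ht, e⟩ := h.exists_extension (b := b) (c := c) (d := d) hab
  exact ⟨_, h.btw_iff_extend.2 ⟨hab, t, ht hcd, rfl⟩, e⟩

theorem inner_pasch {a b c p q : F × F} (h1 : Btw P a p c) (h2 : Btw P b q c)
    (hD : P (cross (a - c) (b - c) * cross (a - c) (b - c)) ∨
      P (cross (q - p) (a - p) * cross (q - p) (a - p))) :
    ∃ x, Btw P p x b ∧ Btw P a x q := by
  obtain ⟨-, s, hs, hs', rfl⟩ := h.btw_iff_convex.1 h1.symm
  obtain ⟨-, t, ht, ht', rfl⟩ := h.btw_iff_convex.1 h2.symm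
  replace hD : P (cross (a - c) (b - c) * cross (a - c) (b - c)) := by
    refine hD.elim id fun hD => ?_
    have := h.mul ht hs'
    refine h.pos_of_mul_pos (x := (t * (1 - s)) * (t * (1 - s))) ?_ (h.mul this this)
    convert hD using 1
    simp only [cross, Prod.fst_sub, Prod.snd_sub, Prod.fst_add, Prod.snd_add, Prod.smul_fst,
      Prod.smul_snd, smul_eq_mul]
    ring
  -- Solving for the intersection of `pb` and `aq` in the basis `a - c`, `b - c` has denominator `1
  -- - st = (1-s) + s(1-t)`.
  have hst : P (1 - s * t) := by
    convert h.add hs' (h.mul hs ht') using 1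
    ring
  obtain ⟨i, hi, hip⟩ := h.exists_inv _ hst
  refine ⟨c + s • (a - c) + (t * (1 - s) * i) • (b - (c + s • (a - c))),
    h.btw_iff_convex.2 ⟨?_, t * (1 - s) * i, h.mul (h.mul ht hs') hip, ?_, rfl⟩,
    h.btw_iff_convex.2 ⟨?_, (1 - s) * i, h.mul hs' hip, ?_, ?_⟩⟩
  · refine (h.pos_dot_self_of_cross (x := a - c) ?_).2
    convert hD using 1
    simp only [cross, Prod.fst_sub, Prod.snd_sub, Prod.fst_add, Prod.snd_add, Prod.smul_fst,
      Prod.smul_snd, smul_eq_mul]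
    ring
  · convert h.mul ht' hip using 1
    linear_combination -hi
  · refine (h.pos_dot_self_of_cross (x := b - c) ?_).2
    convert hD using 1
    simp only [cross, Prod.fst_sub, Prod.snd_sub, Prod.fst_add, Prod.snd_add, Prod.smul_fst,
      Prod.smul_snd, smul_eq_mul]
    ring
  · convert h.mul (h.mul hs ht') hip using 1
    linear_combination -hi
  · ext <;> simp only [Prod.fst_sub, Prod.snd_sub, Prod.fst_add, Prod.snd_add, Prod.smul_fst,
      Prod.smul_snd, smul_eq_mul]
    · linear_combination (1 - s) * (a.1 - c.1) * hi
    · linear_combination (1 - s) * (a.2 - c.2) * hi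

theorem outer_pasch {a b c p q : F × F} (h1 : Btw P a p c) (h2 : Btw P b c q)
    (hD : P (cross (b - a) (q - a) * cross (b - a) (q - a)) ∨
      P (cross (a - b) (q - b) * cross (a - b) (q - b))) :
    ∃ x, Btw P b p x ∧ Btw P a x q := by
  obtain ⟨-, t, ht, ht', rfl⟩ := h.btw_iff_convex.1 h2
  obtain ⟨-, s, hs, hs', rfl⟩ := h.btw_iff_convex.1 h1
  replace hD : P (cross (a - b) (q - b) * cross (a - b) (q - b)) := by
    refine hD.elim (fun hD => ?_) id
    convert hD using 1
    simp only [cross, Prod.fst_sub, Prod.snd_sub]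
    ring
  -- With origin `b`, `p` is `(1-s)a + stq`; the ray `bp` reaches the line `aq` when this is
  -- rescaled to coefficient sum one, that is, divided by `1 - s(1-t)`.
  have hst : P (1 - s * (1 - t)) := by
    convert h.add hs' (h.mul hs ht) using 1
    ring
  obtain ⟨i, hi, hip⟩ := h.exists_inv _ hst
  refine ⟨_, h.btw_iff_extend.2 ⟨?_, s * (1 - t) * i, h.mul (h.mul hs ht') hip, rfl⟩,
    h.btw_iff_convex.2 ⟨?_, s * t * i, h.mul (h.mul hs ht) hip, ?_, ?_⟩⟩
  · refine (h.pos_dot_self_of_cross (x := a - b) ?_).2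
    convert h.mul (h.mul (h.mul hs ht) (h.mul hs ht)) hD using 1
    simp only [cross, Prod.fst_sub, Prod.snd_sub, Prod.fst_add, Prod.snd_add, Prod.smul_fst,
      Prod.smul_snd, smul_eq_mul]
    ring
  · refine (h.pos_dot_self_of_cross (x := a - b) ?_).2
    convert hD using 1
    simp only [cross, Prod.fst_sub, Prod.snd_sub]
    ring
  · convert h.mul hs' hip using 1
    linear_combination -hi
  · ext <;> simp only [Prod.fst_sub, Prod.snd_sub, Prod.fst_add, Prod.snd_add, Prod.smul_fst,
      Prod.smul_snd, smul_eq_mul]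
    · linear_combination s * (a.1 - b.1) * hi - s * t * (q.1 - b.1) * hi
    · linear_combination s * (a.2 - b.2) * hi - s * t * (q.2 - b.2) * hi

/-- A segment `uv` that contains a point `c` with `cu = cv` has midpoint `c`. -/
theorem eq_reflect {c u v : F × F} (h1 : Btw N u c v) (h2 : distSq c u = distSq c v) :
    v = c + c - u := by
  have : dot ((v - c) + (u - c)) ((v - c) + (u - c)) = 0 := by
    refine h.eq_of_hom _ _ fun R _ _ _ φ hN _ => ?_
    have e1 := congrArg φ h1.1
    have e2 := hN _ h1.2
    have e3 := congrArg φ h2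
    have e4 := hN _ (h.dot_self_nonneg (u - c))
    simp only [distSq, dot, cross, map_zero, map_add, map_mul, map_sub, Prod.fst_sub, Prod.snd_sub,
      Prod.fst_add, Prod.snd_add] at e1 e2 e3 e4 ⊢
    -- The points may coincide, so no division is available. Collinearity and equal lengths give
    -- that `(c-v)·(u-c)` and `|u-c|²` have equal squares; both are nonnegative, hence equal.
    have e5 := (mul_self_inj e2 e4).1 (by
      linear_combination (-(φ v.1 - φ c.1) * (φ c.2 - φ u.2) + (φ v.2 - φ c.2) * (φ c.1 - φ u.1)) *
        e1 - ((φ u.1 - φ c.1) * (φ u.1 - φ c.1) + (φ u.2 - φ c.2) * (φ u.2 - φ c.2)) * e3)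
    linear_combination -e3 - 2 * e5
  have := h.dot_self_eq_zero this
  rw [add_eq_zero_iff_eq_neg] at this
  rw [← sub_add_cancel v c, this]
  abel

/-- The power of the point `a`, up to sign: it turns betweenness on a diameter into an inequality
between squared distances. -/
theorem distSq_sub_of_diameter {a c u v : F × F} (h1 : Btw N u c v) (h2 : distSq c u = distSq c v) :
    dot (a - v) (u - a) = distSq c u - distSq c a := by
  obtain rfl := h.eq_reflect h1 h2
  simp only [distSq, dot, Prod.fst_sub, Prod.snd_sub, Prod.fst_add, Prod.snd_add]
  ring

theorem line_circle {a b c : F × F} {ρ : F} (hab : P (distSq a b)) (hρ : N (ρ - distSq c a)) :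
    ∃ s t : F, distSq c (a + s • (b - a)) = ρ ∧ distSq c (a + t • (b - a)) = ρ ∧
      dot (a - (a + t • (b - a))) (a + s • (b - a) - a) = ρ - distSq c a := by
  obtain ⟨i, hi, hip⟩ := h.exists_inv _ hab
  -- A quarter of the discriminant of the quadratic for the parameter along `ab`; the two roots come
  -- from `d` and `-d`. Their product, by Vieta, gives the dot product that puts `a` between the
  -- solutions.
  obtain ⟨d, -, hd⟩ := h.exists_sqrt (dot (a - c) (b - a) * dot (a - c) (b - a) +
    distSq a b * (ρ - distSq c a)) (h.nonneg_of_hom _ fun R _ _ _ φ hN hP => by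
      rw [map_add, map_mul, map_mul]
      exact _root_.add_nonneg (mul_self_nonneg _) (mul_nonneg (hP _ hab).le (hN _ hρ)))
  have e (k : F) (hk : k * k = d * d) : distSq c (a + (i * (k - dot (a - c) (b - a))) • (b - a))
      = ρ := by
    have : distSq c (a + (i * (k - dot (a - c) (b - a))) • (b - a)) = distSq c a +
        2 * (i * (k - dot (a - c) (b - a))) * dot (a - c) (b - a) +
          (i * (k - dot (a - c) (b - a))) * (i * (k - dot (a - c) (b - a))) * distSq a b := by
      simp only [distSq, dot, Prod.fst_sub, Prod.snd_sub, Prod.fst_add, Prod.snd_add, Prod.smul_fst,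
        Prod.smul_snd, smul_eq_mul]
      ring
    rw [this]
    linear_combination (i * (k - dot (a - c) (b - a)) * (k - dot (a - c) (b - a)) +
      ρ - distSq c a) * hi + i * hk + i * hd
  refine ⟨_, _, e d rfl, e (-d) (by ring), ?_⟩
  have : dot (a - (a + (i * (-d - dot (a - c) (b - a))) • (b - a)))
      (a + (i * (d - dot (a - c) (b - a))) • (b - a) - a) =
        - ((i * (-d - dot (a - c) (b - a))) * (i * (d - dot (a - c) (b - a))) * distSq a b) := by
    simp only [distSq, dot, Prod.fst_sub, Prod.snd_sub, Prod.fst_add, Prod.snd_add, Prod.smul_fst,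
      Prod.smul_snd, smul_eq_mul]
    ring
  rw [this]
  linear_combination (i * (d * d - dot (a - c) (b - a) * dot (a - c) (b - a)) +
      ρ - distSq c a) * hi + i * hd

theorem circle_circle {a b c c' : F × F} {ρ ρ' : F} (hc : P (distSq c c')) (ha : distSq c a = ρ)
    (hb : distSq c b = ρ) (ha' : N (ρ' - distSq c' a)) (hb' : N (distSq c' b - ρ')) :
    ∃ e, distSq c e = ρ ∧ distSq c' e = ρ' := by
  obtain ⟨i, hi, hip⟩ := h.exists_inv _ hc
  obtain ⟨j, hj, -⟩ := h.exists_inv _ (h.add h.one h.one)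
  -- With `g = c' - c` and `K = ρ + |g|² - ρ'`, a common point is `c + Xg + Yg⊥` with `X =
  -- K/(2|g|²)` and `Y = y/(2|g|²)`, where `y² = 4ρ|g|² - K²`.
  obtain ⟨y, -, hy⟩ := h.exists_sqrt (4 * ρ * distSq c c' -
      (ρ + distSq c c' - ρ') * (ρ + distSq c c' - ρ')) (h.nonneg_of_hom _ fun R _ _ _ φ hN hP => by
    have e1 := congrArg φ ha
    have e2 := congrArg φ hb
    have e3 := hN _ ha'
    have e4 := hN _ hb'
    simp only [distSq, dot, map_add, map_mul, map_sub, map_ofNat, Prod.fst_sub, Prod.snd_sub]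
      at e1 e2 e3 e4 ⊢
    generalize φ ρ = r at *
    generalize φ ρ' = r' at *
    obtain ⟨g1, hg1⟩ : ∃ g, g = φ c'.1 - φ c.1 := ⟨_, rfl⟩
    obtain ⟨g2, hg2⟩ : ∃ g, g = φ c'.2 - φ c.2 := ⟨_, rfl⟩
    obtain ⟨a1, ha1⟩ : ∃ g, g = φ a.1 - φ c.1 := ⟨_, rfl⟩
    obtain ⟨a2, ha2⟩ : ∃ g, g = φ a.2 - φ c.2 := ⟨_, rfl⟩
    obtain ⟨b1, hb1⟩ : ∃ g, g = φ b.1 - φ c.1 := ⟨_, rfl⟩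
    obtain ⟨b2, hb2⟩ : ∃ g, g = φ b.2 - φ c.2 := ⟨_, rfl⟩
    rw [← hg1, ← hg2]
    rw [← ha1, ← ha2] at e1
    rw [← hb1, ← hb2] at e2
    obtain ⟨K, hK⟩ : ∃ K, K = r + (g1 * g1 + g2 * g2) - r' := ⟨_, rfl⟩
    have k1 : K ≤ 2 * (a1 * g1 + a2 * g2) := by
      rw [hK, ha1, ha2, hg1, hg2]; rw [ha1, ha2] at e1; linarith
    have k2 : 2 * (b1 * g1 + b2 * g2) ≤ K := by
      rw [hK, hb1, hb2, hg1, hg2]; rw [hb1, hb2] at e2; linarith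
    rw [← hK]
    -- The inner point bounds `K` above and the outer point bounds it below. Whichever matters for
    -- the sign of `K` gives `K² ≤ 4ρ|g|²` by Cauchy-Schwarz.
    rcases le_total 0 K with hK0 | hK0
    · have := mul_self_le_mul_self hK0 k1
      rw [← e1]
      nlinarith [sq_nonneg (a1 * g2 - a2 * g1)]
    · have := mul_self_le_mul_self (neg_nonneg.2 hK0) (neg_le_neg k2)
      rw [← e2]
      nlinarith [sq_nonneg (b1 * g2 - b2 * g1)])
  obtain ⟨X, hX⟩ : ∃ X, X = (ρ + distSq c c' - ρ') * i * j := ⟨_, rfl⟩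
  obtain ⟨Y, hY⟩ : ∃ Y, Y = y * i * j := ⟨_, rfl⟩
  have hX2 : 2 * X * distSq c c' = ρ + distSq c c' - ρ' := by
    rw [hX]
    linear_combination (ρ + distSq c c' - ρ') * ((1 + 1) * j * hi + hj)
  have hXY : (X * X + Y * Y) * distSq c c' = ρ := by
    have e1 : 4 * (j * j) = 1 := by linear_combination ((1 + 1) * j + 1) * hj
    rw [hX, hY]
    linear_combination (distSq c c' * i * i * j * j) * hy + ρ * (distSq c c' * i) ^ 2 * e1 +
      ρ * (distSq c c' * i + 1) * hi
  have f1 : distSq c (c + X • (c' - c) + Y • (-(c' - c).2, (c' - c).1)) = ρ := by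
    rw [← hXY]
    simp only [distSq, dot, Prod.fst_sub, Prod.snd_sub, Prod.fst_add, Prod.snd_add, Prod.smul_fst,
      Prod.smul_snd, smul_eq_mul]
    ring
  refine ⟨_, f1, ?_⟩
  have f2 : distSq c' (c + X • (c' - c) + Y • (-(c' - c).2, (c' - c).1)) =
      distSq c (c + X • (c' - c) + Y • (-(c' - c).2, (c' - c).1)) - 2 * X * distSq c c' +
        distSq c c' := by
    simp only [distSq, dot, Prod.fst_sub, Prod.snd_sub, Prod.fst_add, Prod.snd_add, Prod.smul_fst,
      Prod.smul_snd, smul_eq_mul]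
    ring
  rw [f2, f1, hX2]
  ring

theorem distSq_of_btw {a w b : F × F} (H : Btw N a w b) : N (distSq a b - distSq a w) := by
  refine h.nonneg_of_hom _ fun R _ _ _ φ hN _ => ?_
  have e1 := hN _ H.2
  have e2 := hN _ (h.dot_self_nonneg (b - w))
  simp only [distSq, dot, map_add, map_mul, map_sub, Prod.fst_sub, Prod.snd_sub] at e1 e2 ⊢
  linarith

theorem pos_distSq_of_btw {a w b : F × F} (H : Btw P a w b) : P (distSq a b - distSq a w) := by
  convert h.add_nonneg (h.mul (h.add h.one h.one) H.2) (h.dot_self_nonneg (b - w)) using 1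
  simp only [distSq, dot, Prod.fst_sub, Prod.snd_sub]
  ring

/-- As `ca = cb`, one has `|c'b|² - |c'a|² = 2(c'-c)·(a-b)`. A positive left side forces the centers
apart, so the strict circle axiom needs no such hypothesis. -/
theorem pos_distSq_centers {a b c c' : F × F} {ρ ρ' : F} (ha : distSq c a = ρ)
    (hb : distSq c b = ρ) (ha' : N (ρ' - distSq c' a)) (hb' : P (distSq c' b - ρ')) :
    P (distSq c c') := by
  obtain ⟨j, hj, hjp⟩ := h.exists_inv _ (h.add h.one h.one)
  have := h.mul (h.add_nonneg hb' ha') hjp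
  refine (h.pos_dot_self_of_dot (x := c' - c) (y := a - b) ?_).1
  convert h.mul this this using 1
  have : dot (c' - c) (a - b) = (distSq c' b - ρ' + (ρ' - distSq c' a)) * j := by
    rw [← hb] at ha
    simp only [distSq, dot, Prod.fst_sub, Prod.snd_sub] at *
    linear_combination (-((c'.1 - c.1) * (a.1 - b.1) + (c'.2 - c.2) * (a.2 - b.2))) * hj + j * ha
  rw [this]

theorem euclid5 {p q r s t a : F × F} (hD : P (cross (p - t) (r - t) * cross (p - t) (r - t)))
    (hq : q = t + t - p) (hs : s = t + t - r) (h1 : Btw P q a r) :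
    ∃ e, Btw P p a e ∧ Btw P s q e := by
  subst hq hs
  obtain ⟨-, α, hα, hα', rfl⟩ := h.btw_iff_convex.1 h1
  -- In the parallelogram `r - p = q - s`, so scaling `a - p` by `1/(1-α)` from `p` lands at `q +
  -- α/(1-α) (q - s)`.
  obtain ⟨i, hi, hip⟩ := h.exists_inv _ hα'
  refine ⟨t + t - p + (α * i) • (t + t - p - (t + t - r)),
    h.btw_iff_extend.2 ⟨?_, α * i, h.mul hα hip, ?_⟩,
    h.btw_iff_extend.2 ⟨?_, α * i, h.mul hα hip, rfl⟩⟩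
  · refine (h.pos_dot_self_of_cross (x := p - t) ?_).2
    convert h.mul (h.mul hα hα) hD using 1
    simp only [cross, Prod.fst_sub, Prod.snd_sub, Prod.fst_add, Prod.snd_add, Prod.smul_fst,
      Prod.smul_snd, smul_eq_mul]
    ring
  · ext <;> simp only [Prod.fst_sub, Prod.snd_sub, Prod.fst_add, Prod.snd_add, Prod.smul_fst,
      Prod.smul_snd, smul_eq_mul]
    · linear_combination α * (p.1 - t.1 + (r.1 - t.1)) * hi
    · linear_combination α * (p.2 - t.2 + (r.2 - t.2)) * hi
  · refine (h.pos_dot_self_of_cross (x := p - t) ?_).2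
    convert hD using 1
    simp only [cross, Prod.fst_sub, Prod.snd_sub, Prod.fst_add, Prod.snd_add]
    ring

theorem not_btw_self {a b : F × F} : ¬ Btw P a b a := by
  intro H
  refine h.not_pos_zero ?_
  convert (h.btw_iff_convex.1 H).1 using 1
  simp [distSq, dot]

theorem exists_equilateral : ∃ α β γ c₁ c₂ c₃ c₄ : F × F,
    distSq α β = distSq β γ ∧ distSq α β = distSq α γ ∧ P (distSq α β) ∧
      Btw P α c₁ β ∧ distSq α c₁ = distSq c₁ β ∧ Btw P α c₂ γ ∧ distSq α c₂ = distSq c₂ γ ∧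
      Btw P β c₃ γ ∧ distSq β c₃ = distSq c₃ γ ∧ Btw P β c₄ c₂ ∧ Btw P γ c₄ c₁ := by
  have h3 : P 3 := by have := h.pos_natCast 2; norm_num at this; exact this
  obtain ⟨r, -, hr⟩ := h.exists_sqrt_pos h3
  have btw {x y z : F × F} (n : ℕ) (h1 : cross (z - y) (y - x) = 0)
      (h2 : dot (y - z) (x - y) = n + 1) : Btw P x y z :=
    ⟨h1, h2 ▸ h.pos_natCast n⟩
  -- Here `r = √3`. Side `12` makes midpoints and centroid free of denominators, with the dot
  -- products equal to `36` or `24`.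
  refine ⟨(-6, 0), (6, 0), (0, 6 * r), (0, 0), (-3, 3 * r), (3, 3 * r), (0, 2 * r),
    ?_, ?_, ?_, btw 35 ?_ ?_, ?_, btw 35 ?_ ?_, ?_, btw 35 ?_ ?_, ?_, btw 23 ?_ ?_, btw 23 ?_ ?_⟩
  case refine_3 =>
    convert h.pos_natCast 143 using 1
    simp only [distSq, dot, Prod.fst_sub, Prod.snd_sub]
    push_cast
    ring
  all_goals
    simp only [distSq, cross, dot, Prod.fst_sub, Prod.snd_sub]
    push_cast
  · linear_combination (-36) * hr
  · linear_combination (-36) * hr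
  · ring
  · ring
  · ring
  · ring
  · linear_combination 9 * hr
  · ring
  · ring
  · linear_combination 9 * hr
  · ring
  · ring
  · linear_combination 2 * hr
  · ring
  · linear_combination 8 * hr

end IsPositivity

/-! ### Forcing in the plane -/

namespace OrderedKripkeRing

variable {W : Type v} [Preorder W] {K : OrderedKripkeRing.{u, v} W} {V : Type}

variable (K) in
/-- The transition map of the plane. -/
def planeMap {w w' : W} (h : w ≤ w') (x : K.F w × K.F w) : K.F w' × K.F w' :=
  (K.map h x.1, K.map h x.2)

theorem planeMap_planeMap {w w' w'' : W} (h : w ≤ w') (h' : w' ≤ w'') (x : K.F w × K.F w) :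
    K.planeMap h' (K.planeMap h x) = K.planeMap (h.trans h') x := K.plane.map_trans h h' x

theorem map_cross_sub {w w' : W} (h : w ≤ w') (a b c d : K.F w × K.F w) :
    K.map h (cross (a - b) (c - d)) =
      cross (K.planeMap h a - K.planeMap h b)
        (K.planeMap h c - K.planeMap h d) := by
  simp [cross, planeMap]

theorem map_dot_sub {w w' : W} (h : w ≤ w') (a b c d : K.F w × K.F w) :
    K.map h (dot (a - b) (c - d)) =
      dot (K.planeMap h a - K.planeMap h b)
        (K.planeMap h c - K.planeMap h d) := by
  simp [dot, planeMap]

theorem map_distSq {w w' : W} (h : w ≤ w') (a b : K.F w × K.F w) :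
    K.map h (distSq a b) = distSq (K.planeMap h a) (K.planeMap h b) :=
  map_dot_sub h b a b a

theorem btw_map_iff {w w' : W} (h : w ≤ w') (a b c : K.F w × K.F w) :
    Btw (K.Pos w') (K.planeMap h a) (K.planeMap h b) (K.planeMap h c) ↔
      K.map h (cross (c - b) (b - a)) = 0 ∧ K.Pos w' (K.map h (dot (b - c) (a - b))) := by
  rw [map_cross_sub, map_dot_sub, Btw]

namespace IsWeaklyEuclidean

variable (hK : K.IsWeaklyEuclidean)
include hK

theorem plane_eq_of_dense {w : W} {a b : K.F w × K.F w}
    (H : ∀ (w' : W) (h : w ≤ w'), ∃ (w'' : W) (h' : w' ≤ w''),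
      K.planeMap (h.trans h') a = K.planeMap (h.trans h') b) : a = b := by
  refine Prod.ext (hK.eq_of_dense w _ _ fun w' h => ?_) (hK.eq_of_dense w _ _ fun w' h => ?_)
  · obtain ⟨w'', h', e⟩ := H w' h
    exact ⟨w'', h', congrArg Prod.fst e⟩
  · obtain ⟨w'', h', e⟩ := H w' h
    exact ⟨w'', h', congrArg Prod.snd e⟩

theorem exists_pos_distSq {w : W} (a b : K.F w × K.F w)
    (H : ∀ (w' : W) (h : w ≤ w'), K.planeMap h a ≠ K.planeMap h b) :
    ∃ (w' : W) (h : w ≤ w'), K.Pos w' (K.map h (distSq a b)) := by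
  obtain ⟨w', h, e | e | e⟩ := hK.exists_sign (distSq a b)
  · exact ⟨w', h, e⟩
  · exact ((hK.isPositivity w).dot_self_nonneg (b - a) w' h e).elim
  · rw [map_distSq] at e
    exact (H w' h ((hK.isPositivity w').eq_of_distSq_eq_zero e)).elim

/-- A nonzero cross product or a negative dot product, if persistent, refutes `a = b`, `B(a,b,c)`
and `b = c` at once. Stability of equality then gives the vanishing of the cross product. -/
theorem btw_nonneg_of_forces_tbtw {a b c : V} {w : W} {s : V → K.F w × K.F w}
    (H : K.plane.Forces (GeoFormula.tbtw a b c) w s) :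
    Btw (K.Nonneg w) (s a) (s b) (s c) := by
  replace H : ∀ (w' : W) (h : w ≤ w'),
      ¬ ((∀ (w'' : W) (h' : w' ≤ w''),
          K.planeMap h' (K.planeMap h (s a)) ≠ K.planeMap h' (K.planeMap h (s b))) ∧
        (∀ (w'' : W) (h' : w' ≤ w''), ¬ Btw (K.Pos w'') (K.planeMap h' (K.planeMap h (s a)))
          (K.planeMap h' (K.planeMap h (s b))) (K.planeMap h' (K.planeMap h (s c)))) ∧
        (∀ (w'' : W) (h' : w' ≤ w''),
          K.planeMap h' (K.planeMap h (s b)) ≠ K.planeMap h' (K.planeMap h (s c)))) := H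
  simp only [planeMap_planeMap, btw_map_iff] at H
  refine ⟨?_, fun w' h hp => ?_⟩
  · refine hK.eq_of_dense w _ _ fun w' h => ?_
    by_contra! hn
    refine H w' h ⟨fun w'' h' e => hn w'' h' ?_, fun w'' h' e => hn w'' h' ?_,
      fun w'' h' e => hn w'' h' ?_⟩
    · rw [map_cross_sub, e, map_zero]
      simp [cross]
    · rw [e.1, map_zero]
    · rw [map_cross_sub, e, map_zero]
      simp [cross]
  · have hp' (w'' : W) (h' : w' ≤ w'') :
        K.Pos w'' (-K.map (h.trans h') (dot (s b - s c) (s a - s b))) := by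
      have := K.pos_map h' _ hp
      rwa [map_neg, K.map_map] at this
    refine H w' h ⟨fun w'' h' e => hK.not_pos_zero w'' ?_, fun w'' h' e =>
      hK.not_pos_neg w'' _ e.2 (hp' w'' h'), fun w'' h' e => hK.not_pos_zero w'' ?_⟩
    · convert hp' w'' h' using 1
      rw [map_dot_sub, e]
      simp [dot]
    · convert hp' w'' h' using 1
      rw [map_dot_sub, e]
      simp [dot]

/-- If `a ≠ b` and `b ≠ c` are forced, some later node has both squared distances positive.
Collinearity makes their product the square of the dot product, so `B(a,b,c)` holds there. -/
theorem forces_tbtw_of_btw {a b c : V} {w : W} {s : V → K.F w × K.F w}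
    (H : Btw (K.Nonneg w) (s a) (s b) (s c)) :
    K.plane.Forces (GeoFormula.tbtw a b c) w s := by
  rintro w' h ⟨h1, h2, h3⟩
  obtain ⟨w1, l1, p1⟩ := hK.exists_pos_distSq (K.planeMap h (s a)) (K.planeMap h (s b)) h1
  obtain ⟨w2, l2, p2⟩ := hK.exists_pos_distSq (K.planeMap l1 (K.planeMap h (s b)))
    (K.planeMap l1 (K.planeMap h (s c))) fun w'' h' => by
      rw [planeMap_planeMap l1, planeMap_planeMap l1]
      exact h3 w'' (l1.trans h')
  replace p1 := K.pos_map l2 _ p1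
  have l12 := l1.trans l2
  have n2 : ¬ Btw (K.Pos w2) (K.planeMap l12 (K.planeMap h (s a)))
    (K.planeMap l12 (K.planeMap h (s b))) (K.planeMap l12 (K.planeMap h (s c))) := h2 w2 _
  rw [planeMap_planeMap, planeMap_planeMap, planeMap_planeMap, btw_map_iff] at n2
  rw [← map_distSq, ← map_distSq, K.map_map, K.map_map] at p2
  rw [← map_distSq, K.map_map, K.map_map] at p1
  refine n2 ⟨by rw [H.1, map_zero], ?_⟩
  have p3 := hK.mul _ _ _ p1 p2
  refine (hK.isPositivity w2).pos_of_mul (y := K.map (h.trans l12) (dot (s b - s c) (s a - s b)))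
    ?_ (H.2.map _) (H.2.map _)
  convert p3 using 1
  rw [← map_mul, ← map_mul]
  congr 1
  have := H.1
  simp only [cross, dot, distSq, Prod.fst_sub, Prod.snd_sub] at this ⊢
  linear_combination (-(((s c).1 - (s b).1) * ((s b).2 - (s a).2) -
    ((s c).2 - (s b).2) * ((s b).1 - (s a).1))) * this

/-- The double negation allows passing to a node that decides the signs of `t` and `t - 1`, hence
the position of `x` relative to `a` and `b`. -/
theorem forces_col {a b x : V} {w : W} {s : V → K.F w × K.F w} {t : K.F w}
    (hab : K.Pos w (distSq (s a) (s b))) (hx : s x = s a + t • (s b - s a)) :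
    K.plane.Forces (GeoFormula.col a b x) w s := by
  refine (KripkeStructure.forces_neg_neg _ _ _ _).2 fun w' h => ?_
  obtain ⟨w1, l1, h1⟩ := hK.exists_sign (K.map h t)
  obtain ⟨w2, l2, h2⟩ := hK.exists_sign (K.map (h.trans l1) (t - 1))
  refine ⟨w2, l1.trans l2, ?_⟩
  replace h1 : K.Pos w2 (K.map (h.trans (l1.trans l2)) t) ∨
      K.Pos w2 (-K.map (h.trans (l1.trans l2)) t) ∨ K.map (h.trans (l1.trans l2)) t = 0 := by
    rw [K.map_map] at h1
    rcases h1 with h1 | h1 | h1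
    · refine .inl ?_
      simpa [K.map_map] using K.pos_map l2 _ h1
    · refine .inr (.inl ?_)
      simpa [K.map_map] using K.pos_map l2 _ h1
    · refine .inr (.inr ?_)
      simpa [K.map_map] using congrArg (K.map l2) h1
  rw [K.map_map, map_sub, map_one] at h2
  have hab' := K.pos_map (h.trans (l1.trans l2)) _ hab
  rw [map_distSq] at hab'
  have hx' : K.planeMap (h.trans (l1.trans l2)) (s x) =
      (K.planeMap (h.trans (l1.trans l2)) (s a) + K.map (h.trans (l1.trans l2)) t •
        (K.planeMap (h.trans (l1.trans l2)) (s b) - K.planeMap (h.trans (l1.trans l2)) (s a))) := by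
    rw [hx]
    ext <;> simp [planeMap]
  have P2 := hK.isPositivity w2
  change Btw (K.Pos w2) (K.planeMap _ (s x)) (K.planeMap _ (s a)) (K.planeMap _ (s b)) ∨
    K.planeMap _ (s x) = K.planeMap _ (s a) ∨
    Btw (K.Pos w2) (K.planeMap _ (s a)) (K.planeMap _ (s x)) (K.planeMap _ (s b)) ∨
    K.planeMap _ (s x) = K.planeMap _ (s b) ∨
    Btw (K.Pos w2) (K.planeMap _ (s a)) (K.planeMap _ (s b)) (K.planeMap _ (s x))
  generalize K.map (h.trans (l1.trans l2)) t = r at *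
  rw [hx']
  generalize K.planeMap (h.trans (l1.trans l2)) (s a) = a' at *
  generalize K.planeMap (h.trans (l1.trans l2)) (s b) = b' at *
  rcases h1 with h1 | h1 | h1
  · rcases h2 with h2 | h2 | h2
    · refine .inr (.inr (.inr (.inr (P2.btw_iff_extend.2 ⟨hab', _, h2, ?_⟩))))
      ext <;> simp <;> ring
    · exact .inr (.inr (.inl (P2.btw_iff_convex.2 ⟨hab', _, h1, by simpa using h2, rfl⟩)))
    · refine .inr (.inr (.inr (.inl ?_)))
      ext <;> simp [sub_eq_zero.1 h2]
  · refine .inl (P2.btw_iff_extend.2 ⟨by rwa [distSq_comm], _, h1, ?_⟩).symm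
    ext <;> simp <;> ring
  · refine .inr (.inl ?_)
    ext <;> simp [h1]

theorem forces_distinct_iff {a b : V} {w : W} {s : V → K.F w × K.F w} :
    K.plane.Forces (GeoFormula.distinct a b) w s ↔ K.Pos w (distSq (s a) (s b)) :=
  (hK.isPositivity w).exists_btw_iff

theorem angPos_of_forces {a b c : V} {w : W} {s : V → K.F w × K.F w}
    (H : K.plane.Forces (GeoFormula.angPos a b c) w s) :
    AngPos (K.Pos w) (s a) (s b) (s c) := by
  have hP := hK.isPositivity w
  rcases H with ⟨u, v, ⟨d, hd⟩, ⟨e, he⟩, h1, h2⟩ | ⟨d, h1, h2, h3, -, h4, -⟩ |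
    ⟨a', b', c', ⟨u, v, u', v', ⟨d, hd⟩, ⟨e, he⟩, ⟨d', hd'⟩, ⟨e', he'⟩, e1, e2, e3⟩, h1⟩
  · exact hP.angPos_of_apex hd he h1 (hK.forces_distinct_iff.1 h2)
  · exact hP.angPos_of_right h1 h2 h3 (hK.forces_distinct_iff.1 h4)
  · refine hP.angPos_of_congr hd he hd' he' e1 e2 e3 ?_
    rcases h1 with ⟨f, h1, h2, h3, -, h4, -⟩ | ⟨f, h1, h2, h3, -, h4, -⟩
    · obtain ⟨h5, h6⟩ := hP.dot_eq_zero_of_right h1 h2 h3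
      exact (hP.angPos_of_right_triangle h6 h5 (pos_distSq_comm (hK.forces_distinct_iff.1 h4))).1
    · obtain ⟨h5, h6⟩ := hP.dot_eq_zero_of_right h1 h2 h3
      exact (hP.angPos_of_right_triangle ((dot_comm _ _).trans h6)
        (pos_distSq_comm (hK.forces_distinct_iff.1 h4)) h5).2

theorem pos_cross_of_forces {a b c : V} {w : W} {s : V → K.F w × K.F w}
    (H : K.plane.Forces (GeoFormula.angProper a b c) w s) :
    K.Pos w (cross (s a - s b) (s c - s b) * cross (s a - s b) (s c - s b)) := by
  obtain ⟨h1, d, h2, h3⟩ := H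
  exact (hK.isPositivity w).pos_cross_of_angPos (hK.angPos_of_forces h1) h2
    (hK.angPos_of_forces h3)

end IsWeaklyEuclidean
end OrderedKripkeRing

/-! ### The axioms of EG are forced in the plane -/

namespace OrderedKripkeRing.IsWeaklyEuclidean

open GeoFormula Pt KripkeStructure

variable {W : Type v} [Preorder W] {K : OrderedKripkeRing.{u, v} W} (hK : K.IsWeaklyEuclidean)
include hK

theorem forces_stabilityEq : ∀ w s, K.plane.Forces EG.stabilityEq w s :=
  forces_imp_of _ fun _ _ H => hK.plane_eq_of_dense ((forces_neg_neg _ _ _ _).1 H)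

theorem forces_stabilityCong : ∀ w s, K.plane.Forces EG.stabilityCong w s := by
  refine forces_imp_of _ fun w (s : Pt → K.F w × K.F w) H => hK.eq_of_dense w
    (distSq (s a) (s b)) (distSq (s c) (s d)) fun w' h => ?_
  obtain ⟨w'', h', e⟩ := (forces_neg_neg _ _ _ _).1 H w' h
  refine ⟨w'', h', ?_⟩
  rw [map_distSq, map_distSq]
  exact e

theorem forces_a3 : ∀ w s, K.plane.Forces EG.a3 w s := by
  refine forces_imp_of _ fun w (s : Pt → K.F w × K.F w) H => ?_
  replace H : distSq (s a) (s b) = distSq (s c) (s c) := H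
  refine (hK.isPositivity w).eq_of_distSq_eq_zero (H.trans ?_)
  simp [distSq, dot]

theorem forces_a6 : ∀ w s, K.plane.Forces EG.a6 w s :=
  fun _ _ w' _ => (hK.isPositivity w').not_btw_self

theorem forces_a15 : ∀ w s, K.plane.Forces EG.a15 w s :=
  forces_imp_of _ fun w _ H => (hK.isPositivity w).btw_trans_inner H.1 H.2

/-- The dot product defining `B(a,b,c)` is `(t - r) r |ad|²`, so `t > r` at a later node would force
betweenness there. Connectivity applies this with `b` and `c` in both orders. -/
theorem nonneg_of_not_btw {w : W} {a b c d : K.F w × K.F w} {r t : K.F w} (hr : K.Pos w r)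
    (had : K.Pos w (distSq a d)) (hb : b = a + r • (d - a)) (hc : c = a + t • (d - a))
    (H : ∀ (w' : W) (h : w ≤ w'),
      ¬ Btw (K.Pos w') (K.planeMap h a) (K.planeMap h b) (K.planeMap h c)) :
    K.Nonneg w (r - t) := by
  intro w' h hp
  refine H w' h ((btw_map_iff _ _ _ _).2 ⟨?_, ?_⟩)
  · rw [← map_zero (K.map h), hb, hc]
    congr 1
    simp only [cross, Prod.fst_sub, Prod.snd_sub, Prod.fst_add, Prod.snd_add, Prod.smul_fst,
      Prod.smul_snd, smul_eq_mul]
    ring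
  · convert hK.mul w' _ _ (hK.mul w' _ _ hp (K.pos_map h _ hr)) (K.pos_map h _ had) using 1
    rw [← map_neg, ← map_mul, ← map_mul, hb, hc]
    congr 1
    simp only [distSq, dot, Prod.fst_sub, Prod.snd_sub, Prod.fst_add, Prod.snd_add, Prod.smul_fst,
      Prod.smul_snd, smul_eq_mul]
    ring

theorem forces_a17 : ∀ w s, K.plane.Forces EG.a17 w s := by
  refine forces_imp_of _ fun w (s : Pt → K.F w × K.F w) H => ?_
  obtain ⟨h1, h2, h3, h4⟩ := H
  obtain ⟨had, r, hr, -, hb⟩ := (hK.isPositivity w).btw_iff_convex.1 h1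
  obtain ⟨-, t, ht, -, hc⟩ := (hK.isPositivity w).btw_iff_convex.1 h2
  have : r - t = 0 := by
    refine hK.eq_zero w _ (hK.nonneg_of_not_btw hr had hb hc h3) ?_
    rw [neg_sub]
    exact hK.nonneg_of_not_btw ht had hc hb h4
  change s b = s c
  rw [hb, hc, sub_eq_zero.1 this]

theorem pos_distSq_of_forces {i j k l : Pt} {w : W} {s : Pt → K.F w × K.F w}
    (h1 : K.plane.Forces (distinct k l) w s) (h2 : K.plane.Forces (cong i j k l) w s) :
    K.Pos w (distSq (s i) (s j)) := by
  replace h2 : distSq (s i) (s j) = distSq (s k) (s l) := h2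
  rw [h2]
  exact hK.forces_distinct_iff.1 h1

theorem forces_extension : ∀ w s, K.plane.Forces EG.extension w s := by
  refine forces_imp_of _ fun w (s : Pt → K.F w × K.F w) H => ?_
  obtain ⟨e, h1, h2⟩ := (hK.isPositivity w).weak_extension (c := s c) (d := s d)
    (hK.pos_distSq_of_forces H.1 H.2)
  exact ⟨e, hK.forces_tbtw_of_btw h1, h2⟩

theorem forces_strictExtension : ∀ w s, K.plane.Forces EG.strictExtension w s := by
  refine forces_imp_of _ fun w (s : Pt → K.F w × K.F w) H => ?_
  obtain ⟨h1, h2, h3, h4⟩ := H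
  exact (hK.isPositivity w).strict_extension (hK.pos_distSq_of_forces h1 h2)
    (hK.pos_distSq_of_forces h3 h4)

theorem forces_fiveSegment : ∀ w s, K.plane.Forces EG.fiveSegment w s := by
  refine forces_imp_of _ fun w (s : Pt → K.F w × K.F w) H => ?_
  obtain ⟨h1, h2, h3, h4, h5, h6, h7⟩ := H
  exact (hK.isPositivity w).five_segment (hK.forces_distinct_iff.1 h1)
    (hK.btw_nonneg_of_forces_tbtw h2) (hK.btw_nonneg_of_forces_tbtw h3) h4 h5 h6 h7

theorem forces_innerPasch : ∀ w s, K.plane.Forces EG.innerPasch w s := by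
  refine forces_imp_of _ fun w (s : Pt → K.F w × K.F w) H => ?_
  obtain ⟨h1, h2, h3⟩ := H
  exact (hK.isPositivity w).inner_pasch h1 h2 (h3.imp hK.pos_cross_of_forces hK.pos_cross_of_forces)

theorem forces_outerPasch : ∀ w s, K.plane.Forces EG.outerPasch w s := by
  refine forces_imp_of _ fun w (s : Pt → K.F w × K.F w) H => ?_
  obtain ⟨h1, h2, h3⟩ := H
  exact (hK.isPositivity w).outer_pasch h1 h2 (h3.imp hK.pos_cross_of_forces hK.pos_cross_of_forces)

theorem forces_lowerDimension : ∀ w s, K.plane.Forces EG.lowerDimension w s := by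
  intro w s
  obtain ⟨α, β, γ, c₁, c₂, c₃, c₄, h1, h2, h3, h4⟩ := (hK.isPositivity w).exists_equilateral
  have hne (w' : W) (h : w ≤ w') : K.planeMap h α ≠ K.planeMap h β := by
    intro e
    have := K.pos_map h _ h3
    rw [map_distSq, e] at this
    exact hK.not_pos_zero w' (by simpa [distSq, dot] using this)
  exact ⟨α, β, γ, c₁, c₂, c₃, c₄, h1, h2, hne, h4⟩

theorem forces_lineCircle : ∀ w s, K.plane.Forces EG.lineCircle w s := by
  refine forces_imp_of _ fun w (s : Pt → K.F w × K.F w) H => ?_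
  obtain ⟨h1, h2, h3, h4, h5⟩ := H
  replace h2 : distSq (s c) (s u) = distSq (s p) (s q) := h2
  replace h3 : distSq (s c) (s v) = distSq (s p) (s q) := h3
  have hP := hK.isPositivity w
  have hab := hK.forces_distinct_iff.1 h5
  have e := hP.distSq_sub_of_diameter (a := s a) (hP.btw_nonneg h4) (h2.trans h3.symm)
  have hp : K.Pos w (dot (s a - s v) (s u - s a)) := h1.2
  rw [e, h2] at hp
  obtain ⟨x, y, hx, hy, hxy⟩ := hP.line_circle hab (hP.nonneg_of_pos hp)
  refine ⟨s a + x • (s b - s a), s a + y • (s b - s a), hx, hy, ?_, hK.forces_col hab rfl,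
    hK.forces_col hab rfl⟩
  exact ⟨cross_add_smul_sub _ _ _ _, hxy ▸ hp⟩

theorem forces_lineCircleNonstrict : ∀ w s, K.plane.Forces EG.lineCircleNonstrict w s := by
  refine forces_imp_of _ fun w (s : Pt → K.F w × K.F w) H => ?_
  obtain ⟨h1, h2, h3, h4, h5⟩ := H
  replace h2 : distSq (s c) (s u) = distSq (s p) (s q) := h2
  replace h3 : distSq (s c) (s v) = distSq (s p) (s q) := h3
  have hP := hK.isPositivity w
  have hab := hK.forces_distinct_iff.1 h5
  have e := hP.distSq_sub_of_diameter (a := s a) (hK.btw_nonneg_of_forces_tbtw h4)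
    (h2.trans h3.symm)
  have hp := (hK.btw_nonneg_of_forces_tbtw h1).2
  rw [e, h2] at hp
  obtain ⟨x, y, hx, hy, hxy⟩ := hP.line_circle hab hp
  refine ⟨s a + x • (s b - s a), s a + y • (s b - s a), hx, hy, ?_, hK.forces_col hab rfl,
    hK.forces_col hab rfl⟩
  exact hK.forces_tbtw_of_btw ⟨cross_add_smul_sub _ _ _ _, hxy ▸ hp⟩

theorem nonneg_of_inside {w : W} {s : Pt → K.F w × K.F w}
    (h1 : K.plane.Forces (tbtw u a v) w s) (h2 : K.plane.Forces (tbtw u c' v) w s)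
    (h3 : K.plane.Forces (cong c' u p' q') w s) (h4 : K.plane.Forces (cong c' v p' q') w s) :
    K.Nonneg w (distSq (s p') (s q') - distSq (s c') (s a)) := by
  replace h3 : distSq (s c') (s u) = distSq (s p') (s q') := h3
  replace h4 : distSq (s c') (s v) = distSq (s p') (s q') := h4
  rw [← h3, ← (hK.isPositivity w).distSq_sub_of_diameter (hK.btw_nonneg_of_forces_tbtw h2)
    (h3.trans h4.symm)]
  exact (hK.btw_nonneg_of_forces_tbtw h1).2

theorem forces_circleCircle : ∀ w s, K.plane.Forces EG.circleCircle w s := by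
  refine forces_imp_of _ fun w (s : Pt → K.F w × K.F w) H => ?_
  obtain ⟨h1, h2, h3, h4, h5, h6, h7, h8⟩ := H
  have hP := hK.isPositivity w
  have h9 := hK.nonneg_of_inside h2 h3 h4 h5
  have hb := hP.pos_distSq_of_btw h7
  replace h8 : distSq (s c') (s Pt.w) = distSq (s p') (s q') := h8
  rw [h8] at hb
  exact hP.circle_circle (hP.pos_distSq_centers h1 h6 h9 hb) h1 h6 h9 (hP.nonneg_of_pos hb)

theorem forces_circleCircleNonstrict : ∀ w s, K.plane.Forces EG.circleCircleNonstrict w s := by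
  refine forces_imp_of _ fun w (s : Pt → K.F w × K.F w) H => ?_
  obtain ⟨h0, h1, h2, h3, h4, h5, h6, h7, h8⟩ := H
  have hP := hK.isPositivity w
  have hb := hP.distSq_of_btw (hK.btw_nonneg_of_forces_tbtw h7)
  replace h8 : distSq (s c') (s Pt.w) = distSq (s p') (s q') := h8
  rw [h8] at hb
  exact hP.circle_circle (hK.forces_distinct_iff.1 h0) h1 h6 (hK.nonneg_of_inside h2 h3 h4 h5) hb

theorem forces_euclid5 : ∀ w s, K.plane.Forces EG.euclid5 w s := by
  refine forces_imp_of _ fun w (σ : Pt → K.F w × K.F w) H => ?_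
  obtain ⟨h0, h1, h2, h3, h4, -, h5⟩ := H
  have hP := hK.isPositivity w
  replace h1 : distSq (σ p) (σ t) = distSq (σ q) (σ t) := h1
  replace h3 : distSq (σ s) (σ t) = distSq (σ r) (σ t) := h3
  rw [distSq_comm, distSq_comm (σ q)] at h1
  rw [distSq_comm, distSq_comm (σ r)] at h3
  have hq := hP.eq_reflect (hP.btw_nonneg h2) h1
  have hs := hP.eq_reflect (hP.btw_nonneg (Btw.symm h4)) h3.symm
  refine hP.euclid5 ?_ hq hs h5
  rcases h0 with h0 | h0 | h0
  · exact hK.pos_cross_of_forces h0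
  all_goals
    convert hK.pos_cross_of_forces h0 using 1
    simp only [cross, Prod.fst_sub, Prod.snd_sub]
    ring

theorem plane_models : K.plane.Models EG.axiomsEG := by
  intro φ hφ
  simp only [EG.axiomsEG, Set.mem_insert_iff, Set.mem_singleton_iff] at hφ
  rcases hφ with rfl | rfl | rfl | rfl | rfl | rfl | rfl | rfl | rfl | rfl | rfl | rfl | rfl | rfl |
    rfl | rfl | rfl | rfl | rfl | rfl
  · exact hK.forces_stabilityEq
  · exact hK.forces_stabilityCong
  · exact fun w (s : Pt → K.F w × K.F w) => distSq_comm (s a) (s b)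
  · exact forces_imp_of _ fun w s H => H.1.symm.trans H.2
  · exact hK.forces_a3
  · exact hK.forces_a6
  · exact forces_imp_of _ fun w s H => Btw.symm H
  · exact hK.forces_a15
  · exact hK.forces_a17
  · exact hK.forces_extension
  · exact hK.forces_strictExtension
  · exact hK.forces_fiveSegment
  · exact hK.forces_innerPasch
  · exact hK.forces_outerPasch
  · exact hK.forces_lowerDimension
  · exact hK.forces_lineCircle
  · exact hK.forces_lineCircleNonstrict
  · exact hK.forces_circleCircle
  · exact hK.forces_circleCircleNonstrict
  · exact hK.forces_euclid5

end OrderedKripkeRing.IsWeaklyEuclidean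

/-! ### Ordinary structures -/

namespace OrderedKripkeRing

/-- In an ordinary structure the basic axioms imply the order laws. -/
theorem IsBasic.isWeaklyEuclidean_single {F : Type u} [CommRing F] {P : F → Prop}
    (h : (single F P).IsBasic) : (single F P).IsWeaklyEuclidean := by
  have nonneg {x : F} (hx : ¬ P (-x)) : (single F P).Nonneg PUnit.unit x := fun _ _ => hx
  have tri {x : F} (h1 : ¬ P x) (h2 : ¬ P (-x)) : x = 0 :=
    h.eq_zero PUnit.unit x (nonneg h2) (nonneg fun h3 => h1 (neg_neg x ▸ h3))
  refine { h with one := fun _ => ?_, add_nonneg := fun _ x y hx hy => ?_,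
                  exists_sqrt := fun _ x hx => ?_ }
  · change P 1
    by_contra h1
    -- If `1` is not positive then `-1` is, as `1 ≠ 0`; but then so is `(-1)(-1) = 1`.
    refine h.zero_ne_one PUnit.unit (tri h1 fun h2 => h1 ?_).symm
    have h3 : P (-1 * -1) := h.mul PUnit.unit _ _ h2 h2
    simpa using h3
  · change P (x + y)
    by_cases h1 : P y
    · exact h.add PUnit.unit x y hx h1
    · have h2 : y = 0 := tri h1 (hy PUnit.unit le_rfl)
      rw [h2]
      exact (add_zero x).symm ▸ hx
  · obtain ⟨z, hz⟩ := h.exists_mul_self _ x hx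
    by_cases h1 : P (-z)
    · refine ⟨-z, fun _ _ h2 => h.not_pos_neg PUnit.unit _ h1 h2, ?_⟩
      rw [neg_mul_neg, hz]
    · exact ⟨z, nonneg h1, hz⟩

end OrderedKripkeRing

end NonMarkov

theorem mainTheorem1 :
    (∀ {W : Type*} [Preorder W] (K : NonMarkov.OrderedKripkeRing W),
      K.toKripke.Models NonMarkov.FieldFormula.weaklyEuclidean →
        K.plane.Models NonMarkov.EG.axiomsEG) ∧
    (∀ {F : Type*} [CommRing F] (P : F → Prop),
      (NonMarkov.OrderedKripkeRing.single F P).toKripke.Models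
          NonMarkov.FieldFormula.basicAxioms →
        (NonMarkov.OrderedKripkeRing.single F P).plane.Models NonMarkov.EG.axiomsEG) :=
  ⟨fun _ hK => (NonMarkov.OrderedKripkeRing.isWeaklyEuclidean_of_models hK).plane_models,
    fun _ hF =>
      (NonMarkov.OrderedKripkeRing.isBasic_of_models hF).isWeaklyEuclidean_single.plane_models⟩
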